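/- All graphs are simplicial. A connected graph $X$ (with graph distance $d$) is \emph{quasi-median} if it contains neither $K_4^-$ (the complete graph $K_4$ minus an edge) nor $K_{3,2}$ as an induced subgraph and satisfies the \emph{triangle condition} (if $v,w$ are adjacent and $d(u,v)=d(u,w)=k$, then $v,w$ have a common neighbour at distance $k-1$ from $u$) and the \emph{quadrangle condition} (if $d(u,z)=k$ and $v\neq w$ are two neighbours of $z$ with $d(u,v)=d(u,w)=k-1$, then $v,w$ have a common neighbour at distance $k-2$ from $u$). A \emph{clique} is a maximal complete subgraph. A \emph{hyperplane} of $X$ is a class of the equivalence relation on the edges of $X$ generated by identifying two edges whenever they lie in a common clique or are opposite sides of a square (a $4$-cycle). For a hyperplane $J$, let $N(J)$ be the subgraph induced by the endpoints of the edges of $J$. A \emph{sector} delimited by $J$ (resp. a \emph{fiber} of $J$) is a connected component of the graph obtained from $X$ (resp. from $N(J)$) by removing the interiors of the edges of $J$. A hyperplane $H$ \emph{separates} a vertex $x$ from a hyperplane $J$ if $x$ and $N(J)$ lie in distinct sectors delimited by $H$. Two hyperplanes $J_1,J_2$ are \emph{transverse} if there is a prism $C_1\times C_2$ in $X$ (an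 induced subgraph which is the Cartesian product of two cliques) with $C_1\subset J_1$ and $C_2\subset J_2$. Let a group $G$ act by graph automorphisms on a quasi-median graph $X$. The \emph{rotative stabiliser} of a hyperplane $J$ is $\mathrm{stab}_{\circlearrowleft}(J)=\bigcap\{\mathrm{stab}(C)\mid C \text{ a clique in } J\}$. Let $\mathcal{J}$ be a $G$-invariant collection of hyperplanes, and suppose that the action is \emph{$\mathcal{J}$-rotative}: for every $J\in\mathcal{J}$, $\mathrm{stab}_{\circlearrowleft}(J)$ acts freely and transitively on the set of fibers of $J$. Fix a vertex $x_0\in X$, and assume that, whenever $J_1,J_2\in\mathcal{J}$ are transverse, every element of $\mathrm{stab}_{\circlearrowleft}(J_1)$ commutes with every element of $\mathrm{stab}_{\circlearrowleft}(J_2)$. Let $Y$ be the intersection of all the sectors containing $x_0$ which are delimited by a hyperplane of $\mathcal{J}$, and let $\mathrm{Rot}(\mathcal{J})=\langle \mathrm{stab}_{\circlearrowleft}(J) \mid J\in\mathcal{J}\rangle$. Then $$G=\mathrm{Rot}(\mathcal{J})\rtimes \mathrm{stab}(Y),$$ i.e. $\mathrm{Rot}(\mathcal{J})$ is normal in $G$,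 $\mathrm{Rot}(\mathcal{J})\cdot\mathrm{stab}(Y)=G$ and $\mathrm{Rot}(\mathcal{J})\cap\mathrm{stab}(Y)=\{1\}$. Moreover, call a subcollection $\mathcal{J}_0\subset\mathcal{J}$ \emph{$x_0$-peripheral} if, for every $J\in\mathcal{J}_0$, no hyperplane of $\mathcal{J}$ separates $J$ and $x_0$. There is a unique maximal $x_0$-peripheral subcollection $\mathcal{J}_0$ of $\mathcal{J}$, and $\mathrm{Rot}(\mathcal{J})$ decomposes as the graph product $\Delta\mathcal{G}$, where $\Delta$ is the graph whose vertices are the hyperplanes of $\mathcal{J}_0$ and whose edges link two transverse hyperplanes, and $\mathcal{G}=\{\mathrm{stab}_{\circlearrowleft}(J)\mid J\in\mathcal{J}_0\}$; that is, the inclusions $\mathrm{stab}_{\circlearrowleft}(J)\hookrightarrow\mathrm{Rot}(\mathcal{J})$ induce an isomorphism onto $\mathrm{Rot}(\mathcal{J})$ from the quotient of the free product $\ast_{J\in\mathcal{J}_0}\mathrm{stab}_{\circlearrowleft}(J)$ by the normal closure of the commutators $[g,h]$ with $g\in\mathrm{stab}_{\circlearrowleft}(J_1)$, $h\in\mathrm{stab}_{\circlearrowleft}(J_2)$,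 $J_1,J_2$ adjacent in $\Delta$. -/

import Mathlib

open scoped Pointwise

namespace QuasiMedian

universe u v w

variable {V : Type u} {G : Type v}

/-- The complete graph on four vertices minus one edge. -/
def K4Minus : SimpleGraph (Fin 4) :=
  (⊤ : SimpleGraph (Fin 4)).deleteEdges {s(2, 3)}

/-- The complete bipartite graph `K_{3,2}`. -/
def K32 : SimpleGraph (Fin 3 ⊕ Fin 2) :=
  completeBipartiteGraph (Fin 3) (Fin 2)

/-- The triangle condition. -/
def TriangleCondition (X : SimpleGraph V) : Prop :=
  ∀ u v w : V, X.Adj v w → X.dist u v = X.dist u w →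
    ∃ x, X.Adj x v ∧ X.Adj x w ∧ X.dist u x + 1 = X.dist u v

/-- The quadrangle condition. -/
def QuadrangleCondition (X : SimpleGraph V) : Prop :=
  ∀ u z v w : V, v ≠ w → X.Adj z v → X.Adj z w →
    X.dist u v + 1 = X.dist u z → X.dist u w + 1 = X.dist u z →
    ∃ x, X.Adj x v ∧ X.Adj x w ∧ X.dist u x + 2 = X.dist u z

/-- Quasi-median graphs: connected weakly modular graphs with no induced `K_4^-` or `K_{3,2}`. -/
structure IsQuasiMedian (X : SimpleGraph V) : Prop where
  connected : X.Connected
  triangle : TriangleCondition X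
  quadrangle : QuadrangleCondition X
  no_K4Minus : ¬ K4Minus.IsIndContained X
  no_K32 : ¬ K32.IsIndContained X

/-- Two edges which belong to a common clique (a maximal complete subgraph). -/
def InCommonClique (X : SimpleGraph V) (e f : Sym2 V) : Prop :=
  e ∈ X.edgeSet ∧ f ∈ X.edgeSet ∧
    ∃ C : Set V, Maximal X.IsClique C ∧ (∀ a ∈ e, a ∈ C) ∧ (∀ a ∈ f, a ∈ C)

/-- Two edges which are opposite sides of a square `a, b, c, d` (a 4-cycle). -/
def OppositeInSquare (X : SimpleGraph V) (e f : Sym2 V) : Prop :=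
  ∃ a b c d : V, a ≠ c ∧ b ≠ d ∧ X.Adj a b ∧ X.Adj b c ∧ X.Adj c d ∧ X.Adj d a ∧
    e = s(a, b) ∧ f = s(c, d)

/-- A hyperplane, as a set of edges: a class of the equivalence relation on edges generated by
the two relations above. -/
def IsHyperplane (X : SimpleGraph V) (J : Set (Sym2 V)) : Prop :=
  ∃ e ∈ X.edgeSet,
    J = {f | Relation.EqvGen (fun e₁ e₂ => InCommonClique X e₁ e₂ ∨ OppositeInSquare X e₁ e₂) e f}

/-- The vertices of the neighbourhood `N(J)`. -/
def nbhd (J : Set (Sym2 V)) : Set V := {a | ∃ e ∈ J, a ∈ e}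

/-- The sectors delimited by `J`: the (vertex sets of the) connected components of the graph
obtained from `X` by removing the interiors of the edges of `J`. -/
def sectors (X : SimpleGraph V) (J : Set (Sym2 V)) : Set (Set V) :=
  Set.range fun c : (X.deleteEdges J).ConnectedComponent => c.supp

/-- The fibers of `J`: the (vertex sets of the) connected components of the graph obtained from
the subgraph `N(J)` by removing the interiors of the edges of `J`. -/
def fibers (X : SimpleGraph V) (J : Set (Sym2 V)) : Set (Set V) :=
  Set.range fun c : ((X.deleteEdges J).induce (nbhd J)).ConnectedComponent =>
    (Subtype.val '' c.supp : Set V)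

/-- `C` is a clique (maximal complete subgraph) whose edges belong to `J`. -/
def IsCliqueIn (X : SimpleGraph V) (J : Set (Sym2 V)) (C : Set V) : Prop :=
  Maximal X.IsClique C ∧ C.Nontrivial ∧ ∀ a ∈ C, ∀ b ∈ C, a ≠ b → s(a, b) ∈ J

/-- `C₁` and `C₂` are factors, sharing a vertex, of a prism `C₁ × C₂` of `X`: an induced subgraph
isomorphic to the Cartesian product of the two complete graphs, in which `C₁` and `C₂` sit as
slices. -/
def SpanPrism (X : SimpleGraph V) (C₁ C₂ : Set V) : Prop :=
  ∃ φ : ((⊤ : SimpleGraph C₁) □ (⊤ : SimpleGraph C₂)) ↪g X,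
    (∃ y : C₂, ∀ x : C₁, φ (x, y) = x) ∧ (∃ x : C₁, ∀ y : C₂, φ (x, y) = y)

/-- Transverse hyperplanes. -/
def Transverse (X : SimpleGraph V) (J₁ J₂ : Set (Sym2 V)) : Prop :=
  ∃ C₁ C₂ : Set V, IsCliqueIn X J₁ C₁ ∧ IsCliqueIn X J₂ C₂ ∧ SpanPrism X C₁ C₂

/-- `H` separates the sets of vertices `A` and `B`: they lie in distinct sectors. -/
def Separates (X : SimpleGraph V) (H : Set (Sym2 V)) (A B : Set V) : Prop :=
  ∃ S ∈ sectors X H, ∃ T ∈ sectors X H, S ≠ T ∧ A ⊆ S ∧ B ⊆ T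

/-- `𝒥₀` is an `x₀`-peripheral subcollection of `𝒥`. -/
def IsPeripheral (X : SimpleGraph V) (𝒥 : Set (Set (Sym2 V))) (x₀ : V)
    (𝒥₀ : Set (Set (Sym2 V))) : Prop :=
  𝒥₀ ⊆ 𝒥 ∧ ∀ J ∈ 𝒥₀, ¬ ∃ H ∈ 𝒥, Separates X H (nbhd J) {x₀}

/-- The intersection of the sectors containing `x₀` which are delimited by a hyperplane of `𝒥`. -/
def baseRegion (X : SimpleGraph V) (𝒥 : Set (Set (Sym2 V))) (x₀ : V) : Set V :=
  {y | ∀ J ∈ 𝒥, ∀ S ∈ sectors X J, x₀ ∈ S → y ∈ S}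

/-- The graph on a collection of hyperplanes whose edges link two hyperplanes which are
transverse. -/
def transversalityGraph (X : SimpleGraph V) (𝒥₀ : Set (Set (Sym2 V))) : SimpleGraph 𝒥₀ :=
  SimpleGraph.fromRel fun J₁ J₂ => Transverse X J₁.1 J₂.1

section Action

variable [Group G] [MulAction G V]

variable (G) in
/-- The rotative stabiliser of `J`: the intersection of the stabilisers of the cliques in `J`. -/
def rotStab (X : SimpleGraph V) (J : Set (Sym2 V)) : Subgroup G :=
  ⨅ C : {C : Set V // IsCliqueIn X J C}, MulAction.stabilizer G C.1

variable (G) in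
/-- The action is `𝒥`-rotative: for every `J ∈ 𝒥`, the rotative stabiliser of `J` acts freely and
transitively on the set of fibers of `J`. -/
def IsRotative (X : SimpleGraph V) (𝒥 : Set (Set (Sym2 V))) : Prop :=
  ∀ J ∈ 𝒥,
    (∀ g ∈ rotStab G X J, ∀ F ∈ fibers X J, g • F = F → g = 1) ∧
    (∀ F₁ ∈ fibers X J, ∀ F₂ ∈ fibers X J, ∃ g ∈ rotStab G X J, g • F₁ = F₂)

variable (G) in
/-- The subgroup `Rot(𝒥)` generated by the rotative stabilisers of the hyperplanes of `𝒥`. -/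
def rot (X : SimpleGraph V) (𝒥 : Set (Set (Sym2 V))) : Subgroup G :=
  Subgroup.closure {g | ∃ J ∈ 𝒥, g ∈ rotStab G X J}

end Action

section GraphProduct

variable {ι : Type u} (Γ : SimpleGraph ι) (H : ι → Type v) [∀ i, Group (H i)]

/-- The relators `[g, h]`, for `g`, `h` in adjacent vertex-groups. -/
def graphProductRels : Set (Monoid.CoprodI H) :=
  {r | ∃ i j, Γ.Adj i j ∧ ∃ (g : H i) (h : H j),
    r = Monoid.CoprodI.of g * Monoid.CoprodI.of h *
      (Monoid.CoprodI.of g)⁻¹ * (Monoid.CoprodI.of h)⁻¹}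

/-- The graph product of the groups `H i` over the simplicial graph `Γ`. -/
abbrev GraphProduct : Type (max u v) :=
  Monoid.CoprodI H ⧸ Subgroup.normalClosure (graphProductRels Γ H)

/-- The canonical map of a vertex-group to the graph product. -/
def GraphProduct.of (i : ι) : H i →* GraphProduct Γ H :=
  (QuotientGroup.mk' _).comp Monoid.CoprodI.of

end GraphProduct

end QuasiMedian

/-!
# Rotation groups of quasi-median graphs

**Geometry.** Everything about hyperplanes is derived from *gates*: in a quasi-median graph every
vertex `x` has a unique nearest vertex `gate X C x` in a maximal clique `C`. Moving along an edge
whose endpoints have distinct gates, towards `C`, sweeps out a strip of squares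
(`exists_square_towards`); together with the exclusion of `K_4^-` and `K_{3,2}` this shows that a
vertex has at most one neighbour in each other gate class (`eq_of_adj_of_gate_eq`) and that such
neighbours are pairwise adjacent (`adj_of_adj_of_gate_ne`). Consequently the edges with distinct
gates are stable under the relations generating hyperplanes, so that the hyperplane of `C` is
exactly this set of edges (`eq_crossing`), its sectors are the gate classes
(`reachable_deleteEdges_iff`), and its fibers are the traces of the gate classes on the
neighbourhood (`mem_fibers_iff`). The same local facts build a prism on any square whose
consecutive sides lie in distinct hyperplanes (`transverse_of_square`), so if two distinct
hyperplanes are not transverse, the neighbourhood of each lies in one sector of the other.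

**Group theory.** Let `J` be peripheral, and let `P J` be the complement of the sector delimited by
`J` which contains `x₀`. A nontrivial rotation about `J` maps the complement of `P J` into `P J`;
it preserves `P J'` if `J'` is transverse to `J`; and `P J`, `P J'` are disjoint if `J ≠ J'` are
not transverse (`reachable_or_reachable_of_mem_peripherals`). By ping-pong
(`GraphProduct.exists_smul_mem_of_ne_one`), a nontrivial element of the graph product moves `x₀` out
of the base region `Y`. This gives both the injectivity of the map from the graph product and
`Rot(𝒥) ∩ stab(Y) = 1`. Conversely, folding a path back into `Y` one hyperplane at a time uses only
rotations about peripheral hyperplanes (`exists_smul_mem_baseRegion`), which shows that these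
generate `Rot(𝒥)` and that `Rot(𝒥) · stab(Y) = G`.
-/

namespace QuasiMedian

variable {V : Type*} {X : SimpleGraph V} {C : Set V}

/-! ### Gates in maximal cliques -/

/-- Without an induced `K_4^-`, the common neighbours of adjacent vertices are pairwise adjacent. -/
theorem IsQuasiMedian.adj_of_common_neighbors (hX : IsQuasiMedian X) {a b u v : V}
    (hab : X.Adj a b) (hua : X.Adj u a) (hub : X.Adj u b) (hva : X.Adj v a) (hvb : X.Adj v b)
    (huv : u ≠ v) : X.Adj u v := by
  by_contra h
  refine hX.no_K4Minus ⟨⟨⟨![a, b, u, v], ?_⟩, ?_⟩⟩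
  · intro i j hij
    fin_cases i <;> fin_cases j <;>
      simp_all [hab.ne, hab.ne', hua.ne, hua.ne', hub.ne, hub.ne', hva.ne, hva.ne', hvb.ne,
        hvb.ne', huv.symm]
  · intro i j
    change X.Adj (![a, b, u, v] i) (![a, b, u, v] j) ↔ _
    have h' : ¬ X.Adj v u := fun h' => h h'.symm
    fin_cases i <;> fin_cases j <;>
      simp [K4Minus, hab, hab.symm, hua, hua.symm, hub, hub.symm, hva, hva.symm, hvb, hvb.symm,
        h, h']

theorem IsQuasiMedian.false_of_K32 (hX : IsQuasiMedian X) {a b c u v : V}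
    (hab : a ≠ b) (hac : a ≠ c) (hbc : b ≠ c) (huv : u ≠ v)
    (nab : ¬ X.Adj a b) (nac : ¬ X.Adj a c) (nbc : ¬ X.Adj b c) (nuv : ¬ X.Adj u v)
    (hau : X.Adj a u) (hav : X.Adj a v) (hbu : X.Adj b u) (hbv : X.Adj b v)
    (hcu : X.Adj c u) (hcv : X.Adj c v) : False := by
  refine hX.no_K32 ⟨⟨⟨Sum.elim ![a, b, c] ![u, v], ?_⟩, ?_⟩⟩
  · have := hau.ne; have := hav.ne; have := hbu.ne; have := hbv.ne; have := hcu.ne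
    have := hcv.ne
    rintro (i | i) (j | j) hij <;> fin_cases i <;> fin_cases j <;> simp_all [eq_comm]
  · intro i j
    change X.Adj (Sum.elim ![a, b, c] ![u, v] i) (Sum.elim ![a, b, c] ![u, v] j) ↔ _
    rcases i with i | i <;> rcases j with j | j <;> fin_cases i <;> fin_cases j <;>
      simp_all [K32, X.adj_comm]

/-- The vertex `p` of `C` is the gate of `x` in `C`: it is strictly closer to `x` than every other
vertex of `C`, and, `C` being complete, these are then one step further away. -/
def IsGate (X : SimpleGraph V) (C : Set V) (x p : V) : Prop :=
  p ∈ C ∧ ∀ c ∈ C, c ≠ p → X.dist c x = X.dist p x + 1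

theorem dist_le_dist_add_one (hX : IsQuasiMedian X) (a : V) {x y : V} (h : X.Adj x y) :
    X.dist a x ≤ X.dist a y + 1 := by
  have := hX.connected.dist_triangle (u := a) (v := y) (w := x)
  rwa [SimpleGraph.dist_eq_one_iff_adj.2 h.symm] at this

theorem exists_isGate (hX : IsQuasiMedian X) (hC : Maximal X.IsClique C) (x : V) :
    ∃ p, IsGate X C x p := by
  have hne : C.Nonempty := by
    by_contra h
    rw [Set.not_nonempty_iff_eq_empty] at h
    have := hC.2 (y := {x}) (by simp) (by simp [h])
    exact absurd (this rfl) (by simp [h])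
  obtain ⟨p, hp, hmin⟩ := WellFounded.has_min (measure fun c => X.dist c x).wf C hne
  refine ⟨p, hp, fun c hc hcp => ?_⟩
  have h1 : ∀ c ∈ C, X.dist p x ≤ X.dist c x := fun c hc => not_lt.1 (hmin c hc)
  have hadj : X.Adj c p := hC.1 hc hp hcp
  have h2 := dist_le_dist_add_one hX x hadj
  have h3 := h1 c hc
  rw [SimpleGraph.dist_comm, SimpleGraph.dist_comm (u := x) (v := p)] at h2
  by_contra h4
  have h5 : X.dist c x = X.dist p x := by omega
  obtain ⟨u, huc, hup, hu⟩ := hX.triangle x c p hadj (by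
    rw [SimpleGraph.dist_comm, h5, SimpleGraph.dist_comm])
  rw [SimpleGraph.dist_comm, SimpleGraph.dist_comm (u := x) (v := c)] at hu
  have huC : u ∉ C := fun h => by have := h1 u h; omega
  refine huC (hC.2 (y := insert u C) ?_ (Set.subset_insert _ _) (Set.mem_insert _ _))
  -- two vertices of `C` adjacent to `u` force all of `C` to be adjacent to `u`
  rw [SimpleGraph.isClique_insert]
  refine ⟨hC.1, fun d hd hud => ?_⟩
  by_cases hdc : d = c
  · rwa [hdc]
  by_cases hdp : d = p
  · rwa [hdp]
  exact hX.adj_of_common_neighbors hadj huc hup (hC.1 hd hc hdc) (hC.1 hd hp hdp) hud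

open Classical in
/-- The gate of `x` in the maximal clique `C`. (The value is `x` if there is no gate, which does
not happen in a quasi-median graph.) -/
noncomputable def gate (X : SimpleGraph V) (C : Set V) (x : V) : V :=
  if h : ∃ p, IsGate X C x p then h.choose else x

theorem isGate_gate (hX : IsQuasiMedian X) (hC : Maximal X.IsClique C) (x : V) :
    IsGate X C x (gate X C x) := by
  have h := exists_isGate hX hC x
  rw [gate, dif_pos h]
  exact h.choose_spec

theorem IsGate.unique {x p q : V} (hp : IsGate X C x p) (hq : IsGate X C x q) : p = q := by
  by_contra h
  have h1 := hp.2 q hq.1 (Ne.symm h)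
  have h2 := hq.2 p hp.1 h
  omega

theorem IsGate.gate_eq (hX : IsQuasiMedian X) (hC : Maximal X.IsClique C) {x p : V}
    (hp : IsGate X C x p) : gate X C x = p :=
  (isGate_gate hX hC x).unique hp

theorem gate_mem (hX : IsQuasiMedian X) (hC : Maximal X.IsClique C) (x : V) : gate X C x ∈ C :=
  (isGate_gate hX hC x).1

theorem dist_of_ne_gate (hX : IsQuasiMedian X) (hC : Maximal X.IsClique C) {x c : V}
    (hc : c ∈ C) (h : c ≠ gate X C x) : X.dist c x = X.dist (gate X C x) x + 1 :=
  (isGate_gate hX hC x).2 c hc h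

theorem gate_of_mem (hX : IsQuasiMedian X) (hC : Maximal X.IsClique C) {c : V} (hc : c ∈ C) :
    gate X C c = c := by
  by_contra h
  have := dist_of_ne_gate hX hC hc (Ne.symm h)
  simp at this

theorem eq_gate_of_dist_le (hX : IsQuasiMedian X) (hC : Maximal X.IsClique C) {x c : V}
    (hc : c ∈ C) (h : X.dist c x ≤ X.dist (gate X C x) x) : c = gate X C x := by
  by_contra h'
  have := dist_of_ne_gate hX hC hc h'
  omega

theorem dist_gate_eq_of_adj (hX : IsQuasiMedian X) (hC : Maximal X.IsClique C) {x y : V}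
    (h : X.Adj x y) (hne : gate X C x ≠ gate X C y) :
    X.dist (gate X C x) x = X.dist (gate X C y) y := by
  have h1 := dist_of_ne_gate hX hC (gate_mem hX hC x) hne
  have h2 := dist_of_ne_gate hX hC (gate_mem hX hC y) hne.symm
  have h3 := dist_le_dist_add_one hX (gate X C x) h.symm
  have h4 := dist_le_dist_add_one hX (gate X C y) h
  omega

/-- In a triangle, the gates in a maximal clique are pairwise distinct as soon as two of them are;
otherwise the triangle condition produces an induced `K_4^-`. -/
theorem gate_ne_of_triangle (hX : IsQuasiMedian X) (hC : Maximal X.IsClique C) {x y z : V}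
    (hxy : X.Adj x y) (hyz : X.Adj y z) (hxz : X.Adj x z) (hne : gate X C x ≠ gate X C y) :
    gate X C z ≠ gate X C x := by
  intro h
  have h1 := dist_gate_eq_of_adj hX hC hxy hne
  have h2 := dist_gate_eq_of_adj hX hC hyz (by rw [h]; exact hne.symm)
  have h3 := dist_of_ne_gate hX hC (gate_mem hX hC x) hne
  rw [h] at h2
  obtain ⟨u, hux, huz, hu⟩ := hX.triangle (gate X C x) x z hxz (by omega)
  have huy : u ≠ y := by rintro rfl; omega
  have := hX.adj_of_common_neighbors hxz hux huz hxy.symm hyz huy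
  have := dist_le_dist_add_one hX (gate X C x) this.symm
  omega

/-- An edge whose endpoints have distinct gates extends to a clique meeting every sector. -/
theorem exists_common_neighbor_gate_eq (hX : IsQuasiMedian X) (hC : Maximal X.IsClique C)
    {x y r : V} (hxy : X.Adj x y) (hne : gate X C x ≠ gate X C y) (hr : r ∈ C)
    (hrx : r ≠ gate X C x) (hry : r ≠ gate X C y) :
    ∃ z, X.Adj z x ∧ X.Adj z y ∧ gate X C z = r := by
  have h1 := dist_gate_eq_of_adj hX hC hxy hne
  have h2 := dist_of_ne_gate hX hC hr hrx
  have h3 := dist_of_ne_gate hX hC hr hry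
  obtain ⟨z, hzx, hzy, hz⟩ := hX.triangle r x y hxy (by omega)
  refine ⟨z, hzx, hzy, (eq_gate_of_dist_le hX hC hr ?_).symm⟩
  have h4 := gate_ne_of_triangle hX hC hxy hzy.symm hzx.symm hne
  have h5 := dist_gate_eq_of_adj hX hC hzx h4
  omega

theorem gate_eq_of_adj_of_dist (hX : IsQuasiMedian X) (hC : Maximal X.IsClique C) {x x₁ : V}
    (h : X.Adj x x₁) (hd : X.dist (gate X C x) x₁ + 1 = X.dist (gate X C x) x) :
    gate X C x₁ = gate X C x := by
  by_contra hne
  have := dist_gate_eq_of_adj hX hC h (Ne.symm hne)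
  have := dist_of_ne_gate hX hC (gate_mem hX hC x) (Ne.symm hne)
  omega

theorem exists_adj_dist_gate (hX : IsQuasiMedian X) (c : V) {x : V} (h : c ≠ x) :
    ∃ x₁, X.Adj x x₁ ∧ X.dist c x₁ + 1 = X.dist c x := by
  obtain ⟨p, hp⟩ := (hX.connected x c).exists_walk_length_eq_dist
  cases p with
  | nil => exact absurd rfl h
  | @cons _ v _ hadj q =>
    refine ⟨v, hadj, ?_⟩
    have h1 := SimpleGraph.dist_le q
    have h2 := dist_le_dist_add_one hX c hadj
    rw [SimpleGraph.Walk.length_cons, SimpleGraph.dist_comm] at hp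
    rw [SimpleGraph.dist_comm] at h1
    omega

/-- Pushing an edge `xy` with distinct gates one step towards the clique, along a square. -/
theorem exists_square_towards (hX : IsQuasiMedian X) (hC : Maximal X.IsClique C) {x y x₁ : V}
    (hxy : X.Adj x y) (hne : gate X C x ≠ gate X C y) (hx₁ : X.Adj x x₁)
    (hd : X.dist (gate X C x) x₁ + 1 = X.dist (gate X C x) x) :
    ∃ y₁, X.Adj y y₁ ∧ X.Adj x₁ y₁ ∧ X.dist (gate X C y) y₁ + 1 = X.dist (gate X C y) y ∧
      gate X C y₁ = gate X C y := by
  have hg := gate_eq_of_adj_of_dist hX hC hx₁ hd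
  have h1 := dist_gate_eq_of_adj hX hC hxy hne
  have h2 := dist_of_ne_gate hX hC (gate_mem hX hC y) hne.symm
  have h3 := dist_of_ne_gate hX hC (x := x₁) (gate_mem hX hC y) (by rw [hg]; exact hne.symm)
  rw [hg] at h3
  obtain ⟨y₁, hy, hxy₁, hd₁⟩ := hX.quadrangle (gate X C y) x y x₁
    (by rintro rfl; exact hne hg.symm) hxy hx₁ (by omega) (by omega)
  have hd' : X.dist (gate X C y) y₁ + 1 = X.dist (gate X C y) y := by omega
  exact ⟨y₁, hy.symm, hxy₁.symm, hd', gate_eq_of_adj_of_dist hX hC hy.symm hd'⟩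

/-- A vertex has at most one neighbour in each sector other than its own; otherwise, pushing two
such neighbours towards the clique produces an induced `K_{3,2}`. -/
theorem eq_of_adj_of_gate_eq (hX : IsQuasiMedian X) (hC : Maximal X.IsClique C) {x y w : V}
    (hxy : X.Adj x y) (hxw : X.Adj x w) (hne : gate X C x ≠ gate X C y)
    (hyw : gate X C y = gate X C w) : y = w := by
  induction hk : X.dist (gate X C x) x generalizing x y w with
  | zero =>
    have h1 := dist_gate_eq_of_adj hX hC hxy hne
    have h2 := dist_gate_eq_of_adj hX hC hxw (hyw ▸ hne)
    rw [hk] at h1 h2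
    rw [← (hX.connected.dist_eq_zero_iff.1 h1.symm), ← (hX.connected.dist_eq_zero_iff.1 h2.symm),
      hyw]
  | succ k ih =>
    have hpx : gate X C x ≠ x := fun h => by rw [h] at hk; simp at hk
    obtain ⟨x₁, hx₁, hd⟩ := exists_adj_dist_gate hX _ hpx
    have hg := gate_eq_of_adj_of_dist hX hC hx₁ hd
    obtain ⟨y₁, hy₁, hxy₁, hdy, hgy⟩ := exists_square_towards hX hC hxy hne hx₁ hd
    obtain ⟨w₁, hw₁, hxw₁, hdw, hgw⟩ := exists_square_towards hX hC hxw (hyw ▸ hne) hx₁ hd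
    have heq : y₁ = w₁ := ih hxy₁ hxw₁ (by rwa [hg, hgy]) (by rw [hgy, hgw, hyw])
      (by rw [hg]; omega)
    subst heq
    by_contra hyw'
    have e1 := dist_gate_eq_of_adj hX hC hxy hne
    have e2 := dist_of_ne_gate hX hC (gate_mem hX hC x) hne
    have e3 := dist_of_ne_gate hX hC (x := w) (gate_mem hX hC x) (hyw ▸ hne)
    have e4 := dist_gate_eq_of_adj hX hC hxw (hyw ▸ hne)
    have e5 := dist_of_ne_gate hX hC (gate_mem hX hC y) hne.symm
    -- `y`, `w`, `x₁` against `x`, `y₁` form an induced `K_{3,2}`; the distances to the gates of `x`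
    -- and `y` exclude all other adjacencies
    refine hX.false_of_K32 (a := y) (b := w) (c := x₁) (u := x) (v := y₁) hyw' ?_ ?_ ?_
      ?_ ?_ ?_ ?_ hxy.symm hy₁ hxw.symm hw₁ hx₁.symm hxy₁
    · rintro rfl; omega
    · rintro rfl; omega
    · rintro rfl; omega
    · intro h
      exact gate_ne_of_triangle hX hC hxy.symm hxw h hne.symm hyw.symm
    · intro h
      have := dist_le_dist_add_one hX (gate X C x) h
      omega
    · intro h
      have := dist_le_dist_add_one hX (gate X C x) h
      omega
    · intro h
      have := dist_le_dist_add_one hX (gate X C y) h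
      omega

/-- The neighbours of a vertex that lie in other sectors are pairwise adjacent. -/
theorem adj_of_adj_of_gate_ne (hX : IsQuasiMedian X) (hC : Maximal X.IsClique C) {x y w : V}
    (hxy : X.Adj x y) (hxw : X.Adj x w) (hne : gate X C x ≠ gate X C y)
    (hne' : gate X C x ≠ gate X C w) (hyw : y ≠ w) : X.Adj y w := by
  by_cases h : gate X C y = gate X C w
  · exact absurd (eq_of_adj_of_gate_eq hX hC hxy hxw hne h) hyw
  · -- the common neighbour of `x` and `y` with the gate of `w` must be `w`
    obtain ⟨z, hzx, hzy, hz⟩ := exists_common_neighbor_gate_eq hX hC hxy hne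
      (gate_mem hX hC w) hne'.symm (Ne.symm h)
    rw [eq_of_adj_of_gate_eq hX hC hxw hzx.symm hne' hz.symm]
    exact hzy.symm

/-- If one side of a square has distinct gates at its endpoints, so does the opposite side. -/
theorem gate_ne_of_square (hX : IsQuasiMedian X) (hC : Maximal X.IsClique C) {x y z w : V}
    (hxz : x ≠ z) (hyw : y ≠ w) (hxy : X.Adj x y) (hyz : X.Adj y z) (hzw : X.Adj z w)
    (hwx : X.Adj w x) (hne : gate X C x ≠ gate X C y) : gate X C z ≠ gate X C w := by
  by_cases h1 : X.Adj y w
  · have h := gate_ne_of_triangle hX hC hxy.symm hwx.symm h1 hne.symm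
    exact gate_ne_of_triangle hX hC h1.symm hyz hzw.symm h
  by_cases h2 : X.Adj x z
  · have h := gate_ne_of_triangle hX hC hxy hyz h2 hne
    exact (gate_ne_of_triangle hX hC h2.symm hwx.symm hzw h).symm
  have hw : gate X C x = gate X C w := by
    by_contra h
    exact h1 (adj_of_adj_of_gate_ne hX hC hxy hwx.symm hne h hyw)
  have hz : gate X C y = gate X C z := by
    by_contra h
    exact h2 (adj_of_adj_of_gate_ne hX hC hxy.symm hyz hne.symm h hxz)
  rw [← hw, ← hz]
  exact hne.symm

theorem gate_injOn_of_isClique (hX : IsQuasiMedian X) (hC : Maximal X.IsClique C) {D : Set V}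
    (hD : X.IsClique D) {a b : V} (ha : a ∈ D) (hb : b ∈ D)
    (hne : gate X C a ≠ gate X C b) : Set.InjOn (gate X C) D := by
  have hab : a ≠ b := fun h => hne (congrArg _ h)
  have h1 : ∀ c ∈ D, c ≠ a → gate X C c ≠ gate X C a := fun c hc hca => by
    by_cases hcb : c = b
    · rw [hcb]; exact hne.symm
    · exact gate_ne_of_triangle hX hC (hD ha hb hab) (hD hb hc (Ne.symm hcb))
        (hD ha hc (Ne.symm hca)) hne
  intro c hc d hd hcd
  by_contra hcd'
  by_cases hca : c = a
  · subst hca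
    exact h1 d hd (Ne.symm hcd') hcd.symm
  by_cases hda : d = a
  · subst hda
    exact h1 c hc hcd' hcd
  exact gate_ne_of_triangle hX hC (hD hc ha hca) (hD ha hd (Ne.symm hda)) (hD hc hd hcd')
    (h1 c hc hca) hcd.symm

/-! ### Hyperplanes -/

/-- The edges whose endpoints have distinct gates in `C`; this is the hyperplane containing the
edges of `C`. -/
def crossing (X : SimpleGraph V) (C : Set V) : Set (Sym2 V) :=
  {e | e ∈ X.edgeSet ∧ ¬ (e.map (gate X C)).IsDiag}

theorem mk_mem_crossing {x y : V} :
    s(x, y) ∈ crossing X C ↔ X.Adj x y ∧ gate X C x ≠ gate X C y := by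
  simp [crossing]

theorem OppositeInSquare.symm {e f : Sym2 V} (h : OppositeInSquare X e f) :
    OppositeInSquare X f e := by
  obtain ⟨a, b, c, d, hac, hbd, hab, hbc, hcd, hda, rfl, rfl⟩ := h
  exact ⟨c, d, a, b, hac.symm, hbd.symm, hcd, hda, hab, hbc, rfl, rfl⟩

theorem InCommonClique.symm {e f : Sym2 V} (h : InCommonClique X e f) :
    InCommonClique X f e := by
  obtain ⟨he, hf, C, hC, h1, h2⟩ := h
  exact ⟨hf, he, C, hC, h2, h1⟩

theorem mem_crossing_of_rel (hX : IsQuasiMedian X) (hC : Maximal X.IsClique C) {e f : Sym2 V}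
    (h : InCommonClique X e f ∨ OppositeInSquare X e f) (he : e ∈ crossing X C) :
    f ∈ crossing X C := by
  rcases h with ⟨-, hf, D, hD, h1, h2⟩ | ⟨a, b, c, d, hac, hbd, hab, hbc, hcd, hda, rfl, rfl⟩
  · induction e with | h a b => ?_
    induction f with | h c d => ?_
    rw [mk_mem_crossing] at he ⊢
    refine ⟨hf, fun h => ?_⟩
    exact (SimpleGraph.mem_edgeSet X |>.1 hf).ne (gate_injOn_of_isClique hX hC hD.1
      (h1 a (by simp)) (h1 b (by simp)) he.2 (h2 c (by simp)) (h2 d (by simp)) h)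
  · rw [mk_mem_crossing] at he ⊢
    exact ⟨hcd, gate_ne_of_square hX hC hac hbd hab hbc hcd hda he.2⟩

/-- The generating relation of the parallelism of edges. -/
abbrev EdgeRel (X : SimpleGraph V) (e f : Sym2 V) : Prop :=
  InCommonClique X e f ∨ OppositeInSquare X e f

theorem mem_crossing_iff_of_eqvGen (hX : IsQuasiMedian X) (hC : Maximal X.IsClique C)
    {e f : Sym2 V} (h : Relation.EqvGen (EdgeRel X) e f) :
    e ∈ crossing X C ↔ f ∈ crossing X C := by
  induction h with
  | rel e f h =>
    exact ⟨mem_crossing_of_rel hX hC h,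
      mem_crossing_of_rel hX hC (h.imp InCommonClique.symm OppositeInSquare.symm)⟩
  | refl => rfl
  | symm _ _ _ ih => exact ih.symm
  | trans _ _ _ _ _ ih₁ ih₂ => exact ih₁.trans ih₂

/-- An edge with distinct gates is parallel to an edge of the clique, through a strip of squares. -/
theorem eqvGen_gate_edge (hX : IsQuasiMedian X) (hC : Maximal X.IsClique C) {x y : V}
    (hxy : X.Adj x y) (hne : gate X C x ≠ gate X C y) :
    Relation.EqvGen (EdgeRel X) s(x, y) s(gate X C x, gate X C y) := by
  induction hk : X.dist (gate X C x) x generalizing x y with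
  | zero =>
    have h1 := dist_gate_eq_of_adj hX hC hxy hne
    rw [hk] at h1
    rw [hX.connected.dist_eq_zero_iff.1 h1.symm, hX.connected.dist_eq_zero_iff.1 hk]
    exact .refl _
  | succ k ih =>
    have hpx : gate X C x ≠ x := fun h => by rw [h] at hk; simp at hk
    obtain ⟨x₁, hx₁, hd⟩ := exists_adj_dist_gate hX _ hpx
    have hg := gate_eq_of_adj_of_dist hX hC hx₁ hd
    obtain ⟨y₁, hy₁, hxy₁, hdy, hgy⟩ := exists_square_towards hX hC hxy hne hx₁ hd
    have := ih hxy₁ (by rwa [hg, hgy]) (by rw [hg]; omega)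
    rw [hg, hgy] at this
    refine .trans _ _ _ (.rel _ _ (.inr ?_)) this
    refine ⟨x, y, y₁, x₁, ?_, ?_, hxy, hy₁, hxy₁.symm, hx₁.symm, rfl, Sym2.eq_swap⟩
    · rintro rfl; exact hne hgy
    · rintro rfl; exact hne hg.symm

/-- A hyperplane is determined by any of its cliques, through the gates. -/
theorem eq_crossing (hX : IsQuasiMedian X) {J : Set (Sym2 V)} (hJ : IsHyperplane X J)
    (hC : Maximal X.IsClique C) {a b : V} (ha : a ∈ C) (hb : b ∈ C) (hab : a ≠ b)
    (h : s(a, b) ∈ J) : J = crossing X C := by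
  obtain ⟨e, -, rfl⟩ := hJ
  ext f
  have hf : Relation.EqvGen (EdgeRel X) e f ↔ Relation.EqvGen (EdgeRel X) s(a, b) f :=
    ⟨fun h' => .trans _ _ _ (.symm _ _ h) h', fun h' => .trans _ _ _ h h'⟩
  refine hf.trans ⟨fun h' => ?_, fun h' => ?_⟩
  · rw [← mem_crossing_iff_of_eqvGen hX hC h', mk_mem_crossing, gate_of_mem hX hC ha,
      gate_of_mem hX hC hb]
    exact ⟨hC.1 ha hb hab, hab⟩
  · induction f with | h x y => ?_
    rw [mk_mem_crossing] at h'
    refine .trans _ _ _ (.rel _ _ (.inl ?_)) (.symm _ _ (eqvGen_gate_edge hX hC h'.1 h'.2))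
    have hx := gate_mem hX hC x
    have hy := gate_mem hX hC y
    exact ⟨hC.1 ha hb hab, hC.1 hx hy h'.2, C, hC, by simp [ha, hb], by simp [hx, hy]⟩

theorem IsCliqueIn.eq_crossing (hX : IsQuasiMedian X) {J : Set (Sym2 V)} (hJ : IsHyperplane X J)
    (hC : IsCliqueIn X J C) : J = crossing X C := by
  obtain ⟨hm, ⟨a, ha, b, hb, hab⟩, h⟩ := hC
  exact QuasiMedian.eq_crossing hX hJ hm ha hb hab (h a ha b hb hab)

theorem IsHyperplane.adj {J : Set (Sym2 V)} (hJ : IsHyperplane X J)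
    {a b : V} (h : s(a, b) ∈ J) : X.Adj a b := by
  obtain ⟨e, he, rfl⟩ := hJ
  have key : ∀ f g, Relation.EqvGen (EdgeRel X) f g → (f ∈ X.edgeSet ↔ g ∈ X.edgeSet) := by
    intro f g hfg
    induction hfg with
    | rel e f h =>
      rcases h with ⟨he, hf, -⟩ | ⟨a, b, c, d, -, -, hab, -, hcd, -, rfl, rfl⟩
      · exact iff_of_true he hf
      · exact iff_of_true hab hcd
    | refl => rfl
    | symm _ _ _ ih => exact ih.symm
    | trans _ _ _ _ _ ih₁ ih₂ => exact ih₁.trans ih₂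
  exact (key _ _ h).1 he

/-- Every edge lies in a maximal clique, which consists of its endpoints and their common
neighbours. -/
theorem exists_maximal_isClique (hX : IsQuasiMedian X) {a b : V} (hab : X.Adj a b) :
    ∃ C, Maximal X.IsClique C ∧ a ∈ C ∧ b ∈ C := by
  refine ⟨{v | (v = a ∨ X.Adj v a) ∧ (v = b ∨ X.Adj v b)}, ⟨?_, ?_⟩, ?_, ?_⟩
  · rintro u ⟨hua, hub⟩ v ⟨hva, hvb⟩ huv
    rcases hua with rfl | hua
    · exact (hva.resolve_left huv.symm).symm
    rcases hub with rfl | hub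
    · exact (hvb.resolve_left huv.symm).symm
    rcases hva with rfl | hva
    · exact hua
    rcases hvb with rfl | hvb
    · exact hub
    exact hX.adj_of_common_neighbors hab hua hub hva hvb huv
  · intro D hD hle d hd
    have ha : a ∈ D := hle ⟨.inl rfl, .inr hab⟩
    have hb : b ∈ D := hle ⟨.inr hab.symm, .inl rfl⟩
    refine ⟨?_, ?_⟩
    · by_cases h : d = a
      · exact .inl h
      · exact .inr (hD hd ha h)
    · by_cases h : d = b
      · exact .inl h
      · exact .inr (hD hd hb h)
  · exact ⟨.inl rfl, .inr hab⟩
  · exact ⟨.inr hab.symm, .inl rfl⟩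

theorem isCliqueIn_of_mem (hX : IsQuasiMedian X) {J : Set (Sym2 V)} (hJ : IsHyperplane X J)
    (hC : Maximal X.IsClique C) {a b : V} (ha : a ∈ C) (hb : b ∈ C) (h : s(a, b) ∈ J) :
    IsCliqueIn X J C := by
  have hab := (hJ.adj h).ne
  refine ⟨hC, ⟨a, ha, b, hb, hab⟩, fun c hc d hd hcd => ?_⟩
  rw [eq_crossing hX hJ hC ha hb hab h, mk_mem_crossing, gate_of_mem hX hC hc,
    gate_of_mem hX hC hd]
  exact ⟨hC.1 hc hd hcd, hcd⟩

theorem exists_isCliqueIn (hX : IsQuasiMedian X) {J : Set (Sym2 V)} (hJ : IsHyperplane X J)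
    {a b : V} (h : s(a, b) ∈ J) : ∃ C, IsCliqueIn X J C ∧ a ∈ C ∧ b ∈ C := by
  obtain ⟨C, hC, ha, hb⟩ := exists_maximal_isClique hX (hJ.adj h)
  exact ⟨C, isCliqueIn_of_mem hX hJ hC ha hb h, ha, hb⟩

theorem IsHyperplane.nonempty {J : Set (Sym2 V)} (hJ : IsHyperplane X J) :
    ∃ a b, s(a, b) ∈ J := by
  obtain ⟨e, he, rfl⟩ := hJ
  induction e with | h a b => ?_
  exact ⟨a, b, .refl _⟩

theorem IsHyperplane.eq_of_mem {J J' : Set (Sym2 V)} (hX : IsQuasiMedian X)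
    (hJ : IsHyperplane X J) (hJ' : IsHyperplane X J') {a b : V} (h : s(a, b) ∈ J)
    (h' : s(a, b) ∈ J') : J = J' := by
  have hab := hJ.adj h
  obtain ⟨C, hC, ha, hb⟩ := exists_maximal_isClique hX hab
  rw [eq_crossing hX hJ hC ha hb hab.ne h, eq_crossing hX hJ' hC ha hb hab.ne h']

/-! ### Sectors and fibers -/

theorem mem_hyperplane_iff (hX : IsQuasiMedian X) {J : Set (Sym2 V)} (hJ : IsHyperplane X J)
    (hC : IsCliqueIn X J C) {x y : V} :
    s(x, y) ∈ J ↔ X.Adj x y ∧ gate X C x ≠ gate X C y := by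
  rw [hC.eq_crossing hX hJ, mk_mem_crossing]

theorem reachable_deleteEdges_gate (hX : IsQuasiMedian X) {J : Set (Sym2 V)}
    (hJ : IsHyperplane X J) (hC : IsCliqueIn X J C) (x : V) :
    (X.deleteEdges J).Reachable x (gate X C x) := by
  induction hk : X.dist (gate X C x) x generalizing x with
  | zero => rw [hX.connected.dist_eq_zero_iff.1 hk]
  | succ k ih =>
    have hpx : gate X C x ≠ x := fun h => by rw [h] at hk; simp at hk
    obtain ⟨x₁, hx₁, hd⟩ := exists_adj_dist_gate hX _ hpx
    have hg := gate_eq_of_adj_of_dist hX hC.1 hx₁ hd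
    have := ih x₁ (by rw [hg]; omega)
    rw [hg] at this
    refine SimpleGraph.Reachable.trans (SimpleGraph.Adj.reachable ?_) this
    rw [SimpleGraph.deleteEdges_adj, mem_hyperplane_iff hX hJ hC]
    exact ⟨hx₁, fun h => h.2 hg.symm⟩

/-- The sectors delimited by a hyperplane are the sets of vertices with a given gate in one of its
cliques. -/
theorem reachable_deleteEdges_iff (hX : IsQuasiMedian X) {J : Set (Sym2 V)}
    (hJ : IsHyperplane X J) (hC : IsCliqueIn X J C) {x y : V} :
    (X.deleteEdges J).Reachable x y ↔ gate X C x = gate X C y := by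
  constructor
  · rintro ⟨p⟩
    induction p with
    | nil => rfl
    | cons h _ ih =>
      rw [SimpleGraph.deleteEdges_adj, mem_hyperplane_iff hX hJ hC] at h
      refine Eq.trans ?_ ih
      by_contra h'
      exact h.2 ⟨h.1, h'⟩
  · intro h
    have h1 := reachable_deleteEdges_gate hX hJ hC x
    rw [h] at h1
    exact h1.trans (reachable_deleteEdges_gate hX hJ hC y).symm

theorem mem_hyperplane_iff_not_reachable (hX : IsQuasiMedian X) {J : Set (Sym2 V)}
    (hJ : IsHyperplane X J) {x y : V} :
    s(x, y) ∈ J ↔ X.Adj x y ∧ ¬ (X.deleteEdges J).Reachable x y := by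
  obtain ⟨a, b, hab⟩ := hJ.nonempty
  obtain ⟨C, hC, -, -⟩ := exists_isCliqueIn hX hJ hab
  rw [reachable_deleteEdges_iff hX hJ hC, mem_hyperplane_iff hX hJ hC]

theorem mem_nbhd_iff {J : Set (Sym2 V)} {x : V} : x ∈ nbhd J ↔ ∃ y, s(x, y) ∈ J := by
  constructor
  · rintro ⟨e, he, hx⟩
    obtain ⟨y, rfl⟩ := Sym2.mem_iff_exists.1 hx
    exact ⟨y, he⟩
  · rintro ⟨y, hy⟩
    exact ⟨_, hy, by simp⟩

theorem IsCliqueIn.subset_nbhd {J : Set (Sym2 V)} (hC : IsCliqueIn X J C) : C ⊆ nbhd J := by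
  intro c hc
  obtain ⟨d, hd, hdc⟩ := hC.2.1.exists_ne c
  exact mem_nbhd_iff.2 ⟨d, hC.2.2 c hc d hd hdc.symm⟩

/-- The part of the neighbourhood of a hyperplane contained in a sector is connected. -/
theorem reachable_induce_nbhd_gate (hX : IsQuasiMedian X) {J : Set (Sym2 V)}
    (hJ : IsHyperplane X J) (hC : IsCliqueIn X J C) (x : V) (hx : x ∈ nbhd J) :
    ((X.deleteEdges J).induce (nbhd J)).Reachable ⟨x, hx⟩
      ⟨gate X C x, hC.subset_nbhd (gate_mem hX hC.1 x)⟩ := by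
  induction hk : X.dist (gate X C x) x generalizing x with
  | zero => simp [hX.connected.dist_eq_zero_iff.1 hk]
  | succ k ih =>
    have hpx : gate X C x ≠ x := fun h => by rw [h] at hk; simp at hk
    obtain ⟨y, hy⟩ := mem_nbhd_iff.1 hx
    rw [mem_hyperplane_iff hX hJ hC] at hy
    obtain ⟨x₁, hx₁, hd⟩ := exists_adj_dist_gate hX _ hpx
    have hg := gate_eq_of_adj_of_dist hX hC.1 hx₁ hd
    obtain ⟨y₁, hy₁, hxy₁, hdy, hgy⟩ := exists_square_towards hX hC.1 hy.1 hy.2 hx₁ hd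
    have hx₁J : x₁ ∈ nbhd J := mem_nbhd_iff.2 ⟨y₁, by
      rw [mem_hyperplane_iff hX hJ hC, hg, hgy]
      exact ⟨hxy₁, hy.2⟩⟩
    have := ih x₁ hx₁J (by rw [hg]; omega)
    simp only [hg] at this
    refine SimpleGraph.Reachable.trans (SimpleGraph.Adj.reachable ?_) this
    rw [SimpleGraph.comap_adj]
    simp only [Function.Embedding.subtype_apply]
    rw [SimpleGraph.deleteEdges_adj, mem_hyperplane_iff hX hJ hC]
    exact ⟨hx₁, fun h => h.2 hg.symm⟩

theorem mem_fibers_iff (hX : IsQuasiMedian X) {J : Set (Sym2 V)} (hJ : IsHyperplane X J)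
    (hC : IsCliqueIn X J C) {F : Set V} :
    F ∈ fibers X J ↔ ∃ p ∈ C, F = {x ∈ nbhd J | gate X C x = p} := by
  have key : ∀ (p : V) (hp : p ∈ C), (Subtype.val '' (((X.deleteEdges J).induce
      (nbhd J)).connectedComponentMk ⟨p, hC.subset_nbhd hp⟩).supp : Set V) =
      {x ∈ nbhd J | gate X C x = p} := by
    intro p hp
    ext x
    simp only [Set.mem_image, SimpleGraph.ConnectedComponent.mem_supp_iff,
      SimpleGraph.ConnectedComponent.eq, Subtype.exists, exists_and_right, exists_eq_right,
      Set.mem_ofPred_eq]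
    constructor
    · rintro ⟨hx, h⟩
      refine ⟨hx, ?_⟩
      have h' : (X.deleteEdges J).Reachable x p :=
        h.map (SimpleGraph.Embedding.induce (nbhd J)).toHom
      rwa [reachable_deleteEdges_iff hX hJ hC, gate_of_mem hX hC.1 hp] at h'
    · rintro ⟨hx, rfl⟩
      exact ⟨hx, reachable_induce_nbhd_gate hX hJ hC x hx⟩
  constructor
  · rintro ⟨c, rfl⟩
    induction c using SimpleGraph.ConnectedComponent.ind with | h x => ?_
    obtain ⟨x, hx⟩ := x
    refine ⟨gate X C x, gate_mem hX hC.1 x, ?_⟩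
    rw [← key _ (gate_mem hX hC.1 x)]
    simp only
    rw [SimpleGraph.ConnectedComponent.sound (reachable_induce_nbhd_gate hX hJ hC x hx)]
  · rintro ⟨p, hp, rfl⟩
    exact ⟨_, key p hp⟩

end QuasiMedian

namespace QuasiMedian

variable {V : Type*} {X : SimpleGraph V} {C : Set V}

/-! ### Transverse hyperplanes -/

/-- Two distinct hyperplanes containing consecutive sides of a square are transverse: the vertices
of the prism are the vertices next to the first square with prescribed gates in the two cliques. -/
theorem transverse_of_square (hX : IsQuasiMedian X) {J₁ J₂ : Set (Sym2 V)}
    (hJ₁ : IsHyperplane X J₁) (hJ₂ : IsHyperplane X J₂) (hne : J₁ ≠ J₂) {x a b z : V}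
    (ha : s(x, a) ∈ J₁) (hb : s(x, b) ∈ J₂) (hza : X.Adj z a) (hzb : X.Adj z b) (hzx : z ≠ x) :
    Transverse X J₁ J₂ := by
  obtain ⟨C₁, hC₁, hx₁, ha₁⟩ := exists_isCliqueIn hX hJ₁ ha
  obtain ⟨C₂, hC₂, hx₂, hb₂⟩ := exists_isCliqueIn hX hJ₂ hb
  have hm₁ := hC₁.1
  have hm₂ := hC₂.1
  refine ⟨C₁, C₂, hC₁, hC₂, ?_⟩
  have excl : ∀ {u v}, X.Adj u v → gate X C₁ u ≠ gate X C₁ v → gate X C₂ u = gate X C₂ v := by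
    intro u v huv h
    by_contra h'
    exact hne (hJ₁.eq_of_mem hX hJ₂ ((mem_hyperplane_iff hX hJ₁ hC₁).2 ⟨huv, h⟩)
      ((mem_hyperplane_iff hX hJ₂ hC₂).2 ⟨huv, h'⟩))
  have hxa : X.Adj x a := hJ₁.adj ha
  have hxb : X.Adj x b := hJ₂.adj hb
  have g1 : ∀ c ∈ C₁, gate X C₁ c = c := fun c hc => gate_of_mem hX hm₁ hc
  have g2 : ∀ c ∈ C₂, gate X C₂ c = c := fun c hc => gate_of_mem hX hm₂ hc
  have g12 : ∀ c ∈ C₁, gate X C₂ c = x := by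
    intro c hc
    by_cases h : c = x
    · rw [h, g2 x hx₂]
    · rw [← excl (hm₁.1 hx₁ hc (Ne.symm h)) (by rw [g1 x hx₁, g1 c hc]; exact Ne.symm h), g2 x hx₂]
  have g21 : ∀ c ∈ C₂, gate X C₁ c = x := by
    intro c hc
    by_contra h
    have hcx : x ≠ c := by rintro rfl; exact h (g1 x hx₁)
    have := excl (hm₂.1 hx₂ hc hcx) (by rw [g1 x hx₁]; exact Ne.symm h)
    rw [g2 x hx₂, g2 c hc] at this
    exact hcx this
  have hab : a ≠ b := by
    rintro rfl
    exact hxa.ne ((g21 a hb₂).symm.trans (g1 a ha₁))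
  have hbz : gate X C₁ z ≠ gate X C₁ b := gate_ne_of_square hX hm₁ hzx.symm hab hxa hza.symm hzb
    hxb.symm (by rw [g1 x hx₁, g1 a ha₁]; exact hxa.ne)
  have hz2 : gate X C₂ z = b := by rw [excl hzb hbz, g2 b hb₂]
  -- every vertex of `C₂` is an endpoint of an edge of `J₁`
  have nbr : ∀ c ∈ C₂, ∃ e, X.Adj c e ∧ gate X C₁ e ≠ x := by
    intro c hc
    by_cases hcx : c = x
    · exact ⟨a, hcx ▸ hxa, by rw [g1 a ha₁]; exact hxa.ne'⟩
    by_cases hcb : c = b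
    · refine ⟨z, hcb ▸ hzb.symm, ?_⟩
      rw [g21 b hb₂] at hbz
      exact hbz
    have hne2 : gate X C₂ a ≠ gate X C₂ z := by
      rw [g12 a ha₁, hz2]; exact hxb.ne
    obtain ⟨e, hea, hez, he⟩ := exists_common_neighbor_gate_eq hX hm₂ hza.symm hne2 hc
      (by rw [g12 a ha₁]; exact hcx) (by rw [hz2]; exact hcb)
    have hd := dist_gate_eq_of_adj hX hm₂ hea (by rw [he, g12 a ha₁]; exact hcx)
    rw [he, g12 a ha₁, SimpleGraph.dist_eq_one_iff_adj.2 hxa,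
      SimpleGraph.dist_eq_one_iff_adj] at hd
    refine ⟨e, hd, ?_⟩
    rw [← g21 c hc]
    refine gate_ne_of_square hX hm₁ (x := x) (y := a) ?_ ?_ hxa hea.symm hd.symm
      (hm₂.1 hc hx₂ hcx) (by rw [g1 x hx₁, g1 a ha₁]; exact hxa.ne)
    · rintro rfl; exact hcx (he.symm.trans (g2 _ hx₂))
    · rintro rfl; exact hcx ((g2 a hc).symm.trans (g12 a ha₁))
  have ex : ∀ (c : C₁) (d : C₂), ∃ v, gate X C₁ v = c ∧ gate X C₂ v = d ∧
      ((v = d ∧ c.1 = x) ∨ (X.Adj d v ∧ c.1 ≠ x)) := by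
    rintro ⟨c, hc⟩ ⟨d, hd⟩
    simp only
    by_cases hcx : c = x
    · exact ⟨d, by rw [g21 d hd, hcx], g2 d hd, .inl ⟨rfl, hcx⟩⟩
    · suffices h : ∃ v, X.Adj d v ∧ gate X C₁ v = c by
        obtain ⟨v, hdv, hv⟩ := h
        refine ⟨v, hv, ?_, .inr ⟨hdv, hcx⟩⟩
        rw [← excl hdv (by rw [hv, g21 d hd]; exact Ne.symm hcx), g2 d hd]
      obtain ⟨e, hde, he⟩ := nbr d hd
      by_cases hec : gate X C₁ e = c
      · exact ⟨e, hde, hec⟩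
      · obtain ⟨v, hvd, -, hv⟩ := exists_common_neighbor_gate_eq hX hm₁ hde
          (by rw [g21 d hd]; exact he.symm) hc (by rw [g21 d hd]; exact hcx) (Ne.symm hec)
        exact ⟨v, hvd.symm, hv⟩
  choose m hm1 hm2 hm using ex
  -- the same description of `m` with the roles of the two cliques exchanged
  have hm' : ∀ (c : C₁) (d : C₂), (m c d = c ∧ d.1 = x) ∨ (X.Adj c (m c d) ∧ d.1 ≠ x) := by
    intro c d
    rcases hm c d with ⟨h, hcx⟩ | ⟨h, hcx⟩
    · by_cases hdx : d.1 = x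
      · exact .inl ⟨by rw [h, hdx, hcx], hdx⟩
      · refine .inr ⟨?_, hdx⟩
        rw [h, hcx]
        exact hm₂.1 hx₂ d.2 (Ne.symm hdx)
    · by_cases hdx : d.1 = x
      · refine .inl ⟨?_, hdx⟩
        rw [hdx] at h
        exact eq_of_adj_of_gate_eq hX hm₁ h (hm₁.1 hx₁ c.2 (Ne.symm hcx))
          (by rw [hm1, g1 x hx₁]; exact Ne.symm hcx) (by rw [hm1, g1 _ c.2])
      · refine .inr ⟨?_, hdx⟩
        have := dist_gate_eq_of_adj hX hm₁ h (by rw [hm1, g21 _ d.2]; exact Ne.symm hcx)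
        rw [hm1, g21 _ d.2, SimpleGraph.dist_eq_one_iff_adj.2 (hm₂.1 hx₂ d.2 (Ne.symm hdx))] at this
        exact SimpleGraph.dist_eq_one_iff_adj.1 this.symm
  have adj1 : ∀ (c c' : C₁) (d : C₂), c ≠ c' → X.Adj (m c d) (m c' d) := by
    intro c c' d hcc
    have hcc' : c.1 ≠ c'.1 := fun h => hcc (Subtype.ext h)
    rcases hm c d with ⟨h, hcx⟩ | ⟨h, hcx⟩ <;> rcases hm c' d with ⟨h', hcx'⟩ | ⟨h', hcx'⟩
    · exact absurd (hcx.trans hcx'.symm) hcc'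
    · rwa [h]
    · rw [h']; exact h.symm
    · refine adj_of_adj_of_gate_ne hX hm₁ h h' ?_ ?_ fun he => hcc' ?_
      · rw [hm1, g21 _ d.2]; exact Ne.symm hcx
      · rw [hm1, g21 _ d.2]; exact Ne.symm hcx'
      · rw [← hm1 c d, ← hm1 c' d, he]
  have adj2 : ∀ (c : C₁) (d d' : C₂), d ≠ d' → X.Adj (m c d) (m c d') := by
    intro c d d' hdd
    have hdd' : d.1 ≠ d'.1 := fun h => hdd (Subtype.ext h)
    rcases hm' c d with ⟨h, hdx⟩ | ⟨h, hdx⟩ <;> rcases hm' c d' with ⟨h', hdx'⟩ | ⟨h', hdx'⟩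
    · exact absurd (hdx.trans hdx'.symm) hdd'
    · rwa [h]
    · rw [h']; exact h.symm
    · refine adj_of_adj_of_gate_ne hX hm₂ h h' ?_ ?_ fun he => hdd' ?_
      · rw [hm2, g12 _ c.2]; exact Ne.symm hdx
      · rw [hm2, g12 _ c.2]; exact Ne.symm hdx'
      · rw [← hm2 c d, ← hm2 c d', he]
  refine ⟨⟨⟨fun p => m p.1 p.2, ?_⟩, ?_⟩, ⟨⟨x, hx₂⟩, fun c => ?_⟩, ⟨⟨x, hx₁⟩, fun d => ?_⟩⟩
  · rintro ⟨c, d⟩ ⟨c', d'⟩ h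
    simp only at h
    refine Prod.ext (Subtype.ext ?_) (Subtype.ext ?_)
    · change c.1 = c'.1
      rw [← hm1 c d, ← hm1 c' d', h]
    · change d.1 = d'.1
      rw [← hm2 c d, ← hm2 c' d', h]
  · rintro ⟨c, d⟩ ⟨c', d'⟩
    change X.Adj (m c d) (m c' d') ↔ _
    rw [SimpleGraph.boxProd_adj]
    simp only [SimpleGraph.top_adj]
    constructor
    · intro h
      by_cases hd : d = d'
      · refine .inl ⟨?_, hd⟩
        rintro rfl
        subst hd
        exact h.ne rfl
      · refine .inr ⟨hd, ?_⟩
        by_contra hc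
        refine hd (Subtype.ext ?_)
        rw [← hm2 c d, ← hm2 c' d']
        refine excl h ?_
        rw [hm1, hm1]
        exact fun h => hc (Subtype.ext h)
    · rintro (⟨h, rfl⟩ | ⟨h, rfl⟩)
      · exact adj1 _ _ _ h
      · exact adj2 _ _ _ h
  · exact ((hm' c ⟨x, hx₂⟩).resolve_right fun h => h.2 rfl).1
  · exact ((hm ⟨x, hx₁⟩ d).resolve_right fun h => h.2 rfl).1

/-- If `J₁` and `J₂` are distinct and not transverse, then `N(J₂)` lies in a single sector
delimited by `J₁`. -/
theorem reachable_of_not_transverse (hX : IsQuasiMedian X) {J₁ J₂ : Set (Sym2 V)}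
    (hJ₁ : IsHyperplane X J₁) (hJ₂ : IsHyperplane X J₂) (hne : J₁ ≠ J₂)
    (ht : ¬ Transverse X J₁ J₂) {x y : V} (hx : x ∈ nbhd J₂) (hy : y ∈ nbhd J₂) :
    (X.deleteEdges J₁).Reachable x y := by
  obtain ⟨a, b, hab⟩ := hJ₂.nonempty
  obtain ⟨C, hC, -, -⟩ := exists_isCliqueIn hX hJ₂ hab
  have step : ∀ {u v}, X.Adj u v → s(u, v) ∉ J₁ → (X.deleteEdges J₁).Reachable u v :=
    fun h h' => SimpleGraph.Adj.reachable (by rw [SimpleGraph.deleteEdges_adj]; exact ⟨h, h'⟩)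
  have key : ∀ x ∈ nbhd J₂, (X.deleteEdges J₁).Reachable x (gate X C x) := by
    intro x hx
    induction hk : X.dist (gate X C x) x generalizing x with
    | zero => rw [hX.connected.dist_eq_zero_iff.1 hk]
    | succ k ih =>
      have hpx : gate X C x ≠ x := fun h => by rw [h] at hk; simp at hk
      obtain ⟨y, hy⟩ := mem_nbhd_iff.1 hx
      have hy' := (mem_hyperplane_iff hX hJ₂ hC).1 hy
      obtain ⟨x₁, hx₁, hd⟩ := exists_adj_dist_gate hX _ hpx
      have hg := gate_eq_of_adj_of_dist hX hC.1 hx₁ hd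
      obtain ⟨y₁, hy₁, hxy₁, hdy, hgy⟩ := exists_square_towards hX hC.1 hy'.1 hy'.2 hx₁ hd
      have hx₁J : x₁ ∈ nbhd J₂ := mem_nbhd_iff.2 ⟨y₁, by
        rw [mem_hyperplane_iff hX hJ₂ hC, hg, hgy]
        exact ⟨hxy₁, hy'.2⟩⟩
      have := ih x₁ hx₁J (by rw [hg]; omega)
      rw [hg] at this
      refine (step hx₁ fun h => ht ?_).trans this
      refine transverse_of_square hX hJ₁ hJ₂ hne h hy hxy₁.symm hy₁.symm ?_
      rintro rfl
      exact hy'.2 hgy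
  refine (key x hx).trans (SimpleGraph.Reachable.trans ?_ (key y hy).symm)
  have hgx := gate_mem hX hC.1 x
  have hgy := gate_mem hX hC.1 y
  by_cases h : gate X C x = gate X C y
  · rw [h]
  · exact step (hC.1.1 hgx hgy h) fun h' => hne (hJ₁.eq_of_mem hX hJ₂ h' (hC.2.2 _ hgx _ hgy h))

theorem Transverse.symm {J₁ J₂ : Set (Sym2 V)} (h : Transverse X J₁ J₂) :
    Transverse X J₂ J₁ := by
  obtain ⟨C₁, C₂, hC₁, hC₂, φ, ⟨y, hy⟩, ⟨x, hx⟩⟩ := h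
  exact ⟨C₂, C₁, hC₂, hC₁, φ.comp (SimpleGraph.boxProdComm _ _).toEmbedding, ⟨x, hx⟩, ⟨y, hy⟩⟩

theorem Transverse.exists_isCliqueIn_subset_nbhd (hX : IsQuasiMedian X) {J₁ J₂ : Set (Sym2 V)}
    (hJ₁ : IsHyperplane X J₁) (h : Transverse X J₁ J₂) :
    ∃ C, IsCliqueIn X J₂ C ∧ C ⊆ nbhd J₁ := by
  obtain ⟨C₁, C₂, hC₁, hC₂, φ, ⟨y₀, hy₀⟩, ⟨x₀, hx₀⟩⟩ := h
  refine ⟨C₂, hC₂, fun c hc => ?_⟩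
  obtain ⟨x₁, hx₁, hne⟩ := hC₁.2.1.exists_ne x₀.1
  have hne' : x₀ ≠ ⟨x₁, hx₁⟩ := fun h => hne (congrArg Subtype.val h).symm
  have hb : s(φ (x₀, y₀), φ (⟨x₁, hx₁⟩, y₀)) ∈ J₁ := by
    rw [hy₀, hy₀]
    exact hC₁.2.2 _ x₀.2 _ hx₁ hne.symm
  obtain ⟨y, rfl⟩ : ∃ y : C₂, y.1 = c := ⟨⟨c, hc⟩, rfl⟩
  rw [← hx₀ y]
  refine mem_nbhd_iff.2 ⟨φ (⟨x₁, hx₁⟩, y), ?_⟩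
  by_cases hcy : y = y₀
  · rwa [hcy]
  · rw [mem_hyperplane_iff hX hJ₁ hC₁] at hb ⊢
    refine ⟨φ.map_adj_iff.2 (by simp [SimpleGraph.boxProd_adj, hne']), ?_⟩
    refine (gate_ne_of_square hX hC₁.1 (x := φ (x₀, y₀)) (y := φ (⟨x₁, hx₁⟩, y₀)) ?_ ?_
      hb.1 (φ.map_adj_iff.2 ?_) (φ.map_adj_iff.2 ?_) (φ.map_adj_iff.2 ?_) hb.2).symm
    · exact fun h => hne' (congrArg Prod.fst (φ.injective h))
    · exact fun h => hne' (congrArg Prod.fst (φ.injective h)).symm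
    · simp [SimpleGraph.boxProd_adj, Ne.symm hcy]
    · simp [SimpleGraph.boxProd_adj, Ne.symm hne']
    · simp [SimpleGraph.boxProd_adj, hcy]

end QuasiMedian

namespace QuasiMedian

/-! ### A ping-pong lemma for graph products -/

namespace GraphProduct

universe u v

variable {ι : Type u} {Γ : SimpleGraph ι} {H : ι → Type v} [∀ i, Group (H i)]

theorem of_mul_of_comm {i j : ι} (h : Γ.Adj i j) (a : H i) (b : H j) :
    of Γ H i a * of Γ H j b = of Γ H j b * of Γ H i a := by
  have hr : Monoid.CoprodI.of a * Monoid.CoprodI.of b * (Monoid.CoprodI.of a)⁻¹ *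
      (Monoid.CoprodI.of b)⁻¹ ∈ Subgroup.normalClosure (graphProductRels Γ H) :=
    Subgroup.subset_normalClosure ⟨i, j, h, a, b, rfl⟩
  have := (QuotientGroup.eq_one_iff _).2 hr
  rw [QuotientGroup.mk_mul, QuotientGroup.mk_mul, QuotientGroup.mk_mul, QuotientGroup.mk_inv,
    QuotientGroup.mk_inv, mul_inv_eq_one, mul_inv_eq_iff_eq_mul] at this
  exact this

/-- The homomorphism from a graph product defined by homomorphisms on the vertex-groups. -/
def lift {K : Type*} [Group K] (f : ∀ i, H i →* K)
    (hf : ∀ i j, Γ.Adj i j → ∀ a b, Commute (f i a) (f j b)) : GraphProduct Γ H →* K :=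
  QuotientGroup.lift _ (Monoid.CoprodI.lift f) (by
    refine Subgroup.normalClosure_le_normal ?_
    rintro _ ⟨i, j, hij, a, b, rfl⟩
    rw [SetLike.mem_coe, MonoidHom.mem_ker]
    simp only [map_mul, map_inv, Monoid.CoprodI.lift_of]
    rw [(hf i j hij a b).eq]
    group)

theorem lift_of {K : Type*} [Group K] (f : ∀ i, H i →* K)
    (hf : ∀ i j, Γ.Adj i j → ∀ a b, Commute (f i a) (f j b)) (i : ι) (a : H i) :
    lift f hf (of Γ H i a) = f i a := by
  change Monoid.CoprodI.lift f (Monoid.CoprodI.of a) = _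
  rw [Monoid.CoprodI.lift_of]

/-- The element of the graph product represented by a word in the vertex-groups. -/
def wordProd (Γ : SimpleGraph ι) (L : List (Σ i, H i)) : GraphProduct Γ H :=
  (L.map fun s => of Γ H s.1 s.2).prod

theorem wordProd_cons (s : Σ i, H i) (L : List (Σ i, H i)) :
    wordProd Γ (s :: L) = of Γ H s.1 s.2 * wordProd Γ L := by
  simp [wordProd]

theorem exists_wordProd_eq (w : GraphProduct Γ H) : ∃ L, wordProd Γ L = w := by
  induction w using QuotientGroup.induction_on with | H w => ?_
  induction w using Monoid.CoprodI.induction_on with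
  | one => exact ⟨[], rfl⟩
  | of i a => exact ⟨[⟨i, a⟩], by simp [wordProd]; rfl⟩
  | mul x y hx hy =>
    obtain ⟨L, hL⟩ := hx
    obtain ⟨L', hL'⟩ := hy
    exact ⟨L ++ L', by rw [QuotientGroup.mk_mul, ← hL, ← hL']; simp [wordProd]⟩

/-- Ping-pong for graph products. For a word of minimal length, the sets `P i` containing the image
of the base point are detected by the syllables that can be moved to the front; arguing with
minimal length avoids normal forms. -/
theorem exists_smul_mem_of_ne_one {K α : Type*} [Group K] [MulAction K α]
    (Φ : GraphProduct Γ H →* K) (x₀ : α) (P : ι → Set α) (h₀ : ∀ i, x₀ ∉ P i)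
    (hself : ∀ i (a : H i), a ≠ 1 → ∀ z ∉ P i, Φ (of Γ H i a) • z ∈ P i)
    (hdisj : ∀ i j, i ≠ j → ¬ Γ.Adj i j → Disjoint (P i) (P j))
    (hadj : ∀ i j, Γ.Adj i j → ∀ (a : H i) z, Φ (of Γ H i a) • z ∈ P j → z ∈ P j)
    {w : GraphProduct Γ H} (hw : w ≠ 1) : ∃ i, Φ w • x₀ ∈ P i := by
  have key : ∀ L : List (Σ i, H i),
      (∀ L' : List (Σ i, H i), wordProd Γ L' = wordProd Γ L → L.length ≤ L'.length) →
      (∀ j, Φ (wordProd Γ L) • x₀ ∈ P j → ∃ (a : H j) (L' : List (Σ i, H i)),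
        wordProd Γ L' = of Γ H j a * wordProd Γ L ∧ L'.length < L.length) ∧
      (L ≠ [] → ∃ i, Φ (wordProd Γ L) • x₀ ∈ P i) := by
    intro L
    induction L with
    | nil =>
      intro _
      refine ⟨fun j hj => absurd hj ?_, fun h => absurd rfl h⟩
      simpa [wordProd] using h₀ j
    | cons s L ih =>
      obtain ⟨i, h⟩ := s
      intro hmin
      obtain ⟨ih₁, -⟩ := ih fun L' hL' => by
        have := hmin (⟨i, h⟩ :: L') (by rw [wordProd_cons, wordProd_cons, hL'])
        simpa using this
      -- otherwise the first syllable could be merged with another one, giving a shorter word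
      have hnot : Φ (wordProd Γ L) • x₀ ∉ P i := by
        intro hmem
        obtain ⟨a, L', hL', hlen⟩ := ih₁ i hmem
        have := hmin (⟨i, h * a⁻¹⟩ :: L') (by
          rw [wordProd_cons, wordProd_cons, hL', map_mul, map_inv]
          group)
        simp only [List.length_cons] at this
        omega
      have hne : h ≠ 1 := by
        rintro rfl
        have := hmin L (by rw [wordProd_cons, map_one, one_mul])
        simp at this
      have hmem : Φ (wordProd Γ (⟨i, h⟩ :: L)) • x₀ ∈ P i := by
        rw [wordProd_cons, map_mul, mul_smul]
        exact hself i h hne _ hnot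
      refine ⟨fun j hj => ?_, fun _ => ⟨i, hmem⟩⟩
      by_cases hij : i = j
      · subst hij
        refine ⟨h⁻¹, L, ?_, by simp⟩
        rw [wordProd_cons, map_inv, inv_mul_cancel_left]
      by_cases hΓ : Γ.Adj i j
      · rw [wordProd_cons, map_mul, mul_smul] at hj
        obtain ⟨a, L', hL', hlen⟩ := ih₁ j (hadj i j hΓ h _ hj)
        refine ⟨a, ⟨i, h⟩ :: L', ?_, by simpa using hlen⟩
        rw [wordProd_cons, wordProd_cons, hL', ← mul_assoc, of_mul_of_comm hΓ, mul_assoc]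
      · exact absurd hj (Set.disjoint_left.1 (hdisj i j hij hΓ) hmem)
  obtain ⟨L, hL, hmin⟩ := WellFounded.has_min (measure fun L : List (Σ i, H i) => L.length).wf
    {L | wordProd Γ L = w} (exists_wordProd_eq w)
  have hL : wordProd Γ L = w := hL
  obtain ⟨-, h⟩ := key L fun L' hL' => not_lt.1 (hmin L' (hL'.trans hL))
  rw [← hL]
  refine h ?_
  rintro rfl
  exact hw hL.symm

end GraphProduct

end QuasiMedian

namespace QuasiMedian

variable {V : Type*} {X : SimpleGraph V} {C : Set V}

/-! ### Automorphisms and rotative stabilisers -/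

section Action

variable {G : Type*} [Group G] [MulAction G V]

/-- The translate of a set of edges by a group element. -/
abbrev translate (g : G) (J : Set (Sym2 V)) : Set (Sym2 V) :=
  Sym2.map (fun a => g • a) '' J

theorem mk_mem_translate_iff {g : G} {J : Set (Sym2 V)} {x y : V} :
    s(g • x, g • y) ∈ translate g J ↔ s(x, y) ∈ J := by
  have hinj : Function.Injective (Sym2.map fun a : V => g • a) :=
    Sym2.map.injective (MulAction.injective g)
  exact hinj.mem_set_image (s := J) (a := s(x, y))

theorem translate_inv_translate (g : G) (J : Set (Sym2 V)) :
    translate g⁻¹ (translate g J) = J := by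
  rw [translate, translate, Set.image_image]
  simp [Sym2.map_map]

theorem translate_translate_inv (g : G) (J : Set (Sym2 V)) :
    translate g (translate g⁻¹ J) = J := by
  simpa using translate_inv_translate g⁻¹ J

theorem mem_rotStab {J : Set (Sym2 V)} {r : G} :
    r ∈ rotStab G X J ↔ ∀ C, IsCliqueIn X J C → r • C = C := by
  simp [rotStab, Subgroup.mem_iInf, MulAction.mem_stabilizer_iff]

/-- An element of a group of automorphisms, as an automorphism of the graph. -/
def smulIso (hact : ∀ (g : G) (a b : V), X.Adj (g • a) (g • b) ↔ X.Adj a b) (g : G) : X ≃g X :=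
  ⟨MulAction.toPerm g, hact g _ _⟩

variable (hact : ∀ (g : G) (a b : V), X.Adj (g • a) (g • b) ↔ X.Adj a b)
include hact

theorem dist_smul_smul (g : G) (x y : V) : X.dist (g • x) (g • y) = X.dist x y := by
  have key : ∀ (g : G) (x y : V), X.edist (g • x) (g • y) ≤ X.edist x y := by
    intro g x y
    refine le_iInf fun p => ?_
    exact (SimpleGraph.edist_le (p.map (smulIso hact g).toHom)).trans (by simp)
  have h := key g⁻¹ (g • x) (g • y)
  rw [inv_smul_smul, inv_smul_smul] at h
  rw [SimpleGraph.dist, SimpleGraph.dist, le_antisymm (key g x y) h]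

theorem isClique_smul {D : Set V} (hD : X.IsClique D) (g : G) : X.IsClique (g • D) := by
  rintro _ ⟨a, ha, rfl⟩ _ ⟨b, hb, rfl⟩ hab
  exact (hact g a b).2 (hD ha hb fun h => hab (congrArg _ h))

theorem maximal_isClique_smul (hC : Maximal X.IsClique C) (g : G) :
    Maximal X.IsClique (g • C) := by
  refine ⟨isClique_smul hact hC.1 g, fun D hD hle => ?_⟩
  have h := hC.2 (isClique_smul hact hD g⁻¹) (Set.subset_smul_set_iff.2 (by simpa using hle))
  exact Set.smul_set_subset_smul_set_iff (a := g⁻¹).1 (by simpa using h)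

theorem isCliqueIn_smul {J : Set (Sym2 V)} (hC : IsCliqueIn X J C) (g : G) :
    IsCliqueIn X (translate g J) (g • C) := by
  refine ⟨maximal_isClique_smul hact hC.1 g, hC.2.1.image (MulAction.injective g), ?_⟩
  rintro _ ⟨a, ha, rfl⟩ _ ⟨b, hb, rfl⟩ hab
  exact mk_mem_translate_iff.2 (hC.2.2 a ha b hb fun h => hab (congrArg _ h))

theorem gate_smul (hX : IsQuasiMedian X) (hC : Maximal X.IsClique C) (g : G) (x : V) :
    gate X (g • C) (g • x) = g • gate X C x := by
  refine IsGate.gate_eq hX (maximal_isClique_smul hact hC g)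
    ⟨Set.smul_mem_smul_set (gate_mem hX hC x), ?_⟩
  rintro _ ⟨c, hc, rfl⟩ h
  change X.dist (g • c) _ = _
  rw [dist_smul_smul hact, dist_smul_smul hact]
  exact dist_of_ne_gate hX hC hc fun h' => h (congrArg _ h')

theorem reachable_smul {J : Set (Sym2 V)} {x y : V} (h : (X.deleteEdges J).Reachable x y)
    (g : G) : (X.deleteEdges (translate g J)).Reachable (g • x) (g • y) := by
  refine h.map (⟨fun a => g • a, fun {a b} hab => ?_⟩ :
    X.deleteEdges J →g X.deleteEdges (translate g J))
  rw [SimpleGraph.deleteEdges_adj] at hab ⊢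
  exact ⟨(hact g _ _).2 hab.1, fun h => hab.2 (mk_mem_translate_iff.1 h)⟩

theorem conj_mem_rotStab {J : Set (Sym2 V)} {r : G} (hr : r ∈ rotStab G X J) (g : G) :
    g * r * g⁻¹ ∈ rotStab G X (translate g J) := by
  rw [mem_rotStab] at hr ⊢
  intro C hC
  have := hr (g⁻¹ • C) (by
    have := isCliqueIn_smul hact hC g⁻¹
    rwa [translate_inv_translate] at this)
  rw [mul_smul, mul_smul, this, smul_inv_smul]

theorem gate_smul_of_mem_rotStab (hX : IsQuasiMedian X) {J : Set (Sym2 V)}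
    (hC : IsCliqueIn X J C) {r : G} (hr : r ∈ rotStab G X J) (x : V) :
    gate X C (r • x) = r • gate X C x := by
  rw [← gate_smul hact hX hC.1, mem_rotStab.1 hr C hC]

theorem smul_mem_nbhd (hX : IsQuasiMedian X) {J : Set (Sym2 V)} (hJ : IsHyperplane X J)
    {r : G} (hr : r ∈ rotStab G X J) {x : V} (hx : x ∈ nbhd J) : r • x ∈ nbhd J := by
  obtain ⟨y, hy⟩ := mem_nbhd_iff.1 hx
  obtain ⟨C, hC, -⟩ := exists_isCliqueIn hX hJ hy
  refine mem_nbhd_iff.2 ⟨r • y, ?_⟩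
  rw [mem_hyperplane_iff hX hJ hC] at hy ⊢
  rw [gate_smul_of_mem_rotStab hact hX hC hr, gate_smul_of_mem_rotStab hact hX hC hr]
  exact ⟨(hact _ _ _).2 hy.1, fun h => hy.2 (MulAction.injective r h)⟩

theorem smul_fiber (hX : IsQuasiMedian X) {J : Set (Sym2 V)} (hJ : IsHyperplane X J)
    (hC : IsCliqueIn X J C) {r : G} (hr : r ∈ rotStab G X J) (p : V) :
    r • {x ∈ nbhd J | gate X C x = p} = {x ∈ nbhd J | gate X C x = r • p} := by
  ext x
  rw [Set.mem_smul_set_iff_inv_smul_mem]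
  have hr' := inv_mem hr
  constructor
  · rintro ⟨h, rfl⟩
    have := smul_mem_nbhd hact hX hJ hr h
    rw [smul_inv_smul] at this
    exact ⟨this, by rw [gate_smul_of_mem_rotStab hact hX hC hr', smul_inv_smul]⟩
  · rintro ⟨h, h'⟩
    exact ⟨smul_mem_nbhd hact hX hJ hr' h, by
      rw [gate_smul_of_mem_rotStab hact hX hC hr', h', inv_smul_smul]⟩

variable {𝒥 : Set (Set (Sym2 V))}

/-- Rotative stabilisers act freely on the vertices of each clique of the hyperplane. -/
theorem eq_one_of_smul_eq (hX : IsQuasiMedian X) (hrot : IsRotative G X 𝒥) {J : Set (Sym2 V)}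
    (hJ𝒥 : J ∈ 𝒥) (hJ : IsHyperplane X J) (hC : IsCliqueIn X J C) {r : G}
    (hr : r ∈ rotStab G X J) {p : V} (hp : p ∈ C) (h : r • p = p) : r = 1 :=
  (hrot J hJ𝒥).1 r hr _ ((mem_fibers_iff hX hJ hC).2 ⟨p, hp, rfl⟩)
    (by rw [smul_fiber hact hX hJ hC hr, h])

/-- Rotative stabilisers act transitively on the vertices of each clique of the hyperplane. -/
theorem exists_mem_rotStab_smul_eq (hX : IsQuasiMedian X) (hrot : IsRotative G X 𝒥)
    {J : Set (Sym2 V)} (hJ𝒥 : J ∈ 𝒥) (hJ : IsHyperplane X J) {p q : V} (hpq : s(p, q) ∈ J) :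
    ∃ r ∈ rotStab G X J, r • p = q := by
  obtain ⟨C, hC, hp, hq⟩ := exists_isCliqueIn hX hJ hpq
  obtain ⟨r, hr, h⟩ := (hrot J hJ𝒥).2 _ ((mem_fibers_iff hX hJ hC).2 ⟨p, hp, rfl⟩) _
    ((mem_fibers_iff hX hJ hC).2 ⟨q, hq, rfl⟩)
  refine ⟨r, hr, ?_⟩
  rw [smul_fiber hact hX hJ hC hr] at h
  have hrp : r • p ∈ C := by
    rw [← mem_rotStab.1 hr C hC]
    exact Set.smul_mem_smul_set hp
  have hmem : r • p ∈ {x ∈ nbhd J | gate X C x = r • p} :=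
    ⟨hC.subset_nbhd hrp, gate_of_mem hX hC.1 hrp⟩
  rw [h] at hmem
  rw [← hmem.2, gate_of_mem hX hC.1 hrp]

/-- A nontrivial rotation about `J` fixes no sector delimited by `J`. -/
theorem not_reachable_smul (hX : IsQuasiMedian X) (hrot : IsRotative G X 𝒥) {J : Set (Sym2 V)}
    (hJ𝒥 : J ∈ 𝒥) (hJ : IsHyperplane X J) {r : G} (hr : r ∈ rotStab G X J) (hr1 : r ≠ 1)
    {x z : V} (h : (X.deleteEdges J).Reachable x z) :
    ¬ (X.deleteEdges J).Reachable x (r • z) := by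
  obtain ⟨a, b, hab⟩ := hJ.nonempty
  obtain ⟨C, hC, -⟩ := exists_isCliqueIn hX hJ hab
  rw [reachable_deleteEdges_iff hX hJ hC] at h ⊢
  rw [gate_smul_of_mem_rotStab hact hX hC hr, h]
  exact fun h' => hr1 (eq_one_of_smul_eq hact hX hrot hJ𝒥 hJ hC hr (gate_mem hX hC.1 z) h'.symm)

/-- A rotation about `J₁` preserves each sector of a hyperplane transverse to `J₁`. -/
theorem reachable_smul_of_transverse (hX : IsQuasiMedian X) {J₁ J₂ : Set (Sym2 V)}
    (hJ₁ : IsHyperplane X J₁) (hJ₂ : IsHyperplane X J₂) (hne : J₁ ≠ J₂)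
    (ht : Transverse X J₁ J₂) {r : G} (hr : r ∈ rotStab G X J₁) (z : V) :
    (X.deleteEdges J₂).Reachable (r • z) z := by
  obtain ⟨C, hC, hCJ⟩ := ht.exists_isCliqueIn_subset_nbhd hX hJ₁
  -- a vertex of `N(J₁)` is moved inside a clique of `J₁`, none of whose edges is in `J₂`
  have hN : ∀ c ∈ nbhd J₁, (X.deleteEdges J₂).Reachable (r • c) c := by
    intro c hc
    obtain ⟨y, hy⟩ := mem_nbhd_iff.1 hc
    obtain ⟨D, hD, hcD, -⟩ := exists_isCliqueIn hX hJ₁ hy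
    have hrD : r • c ∈ D := by
      rw [← mem_rotStab.1 hr D hD]
      exact Set.smul_mem_smul_set hcD
    by_cases h : r • c = c
    · rw [h]
    · refine SimpleGraph.Adj.reachable ?_
      rw [SimpleGraph.deleteEdges_adj]
      exact ⟨hD.1.1 hrD hcD h, fun h' => hne (hJ₁.eq_of_mem hX hJ₂ (hD.2.2 _ hrD _ hcD h) h')⟩
  -- hence the edges of `r • C` still cross `J₂`, so `r` preserves `J₂`
  have hrC : IsCliqueIn X J₂ (r • C) := by
    obtain ⟨a, ha, b, hb, hab⟩ := hC.2.1
    refine isCliqueIn_of_mem hX hJ₂ (maximal_isClique_smul hact hC.1 r)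
      (Set.smul_mem_smul_set ha) (Set.smul_mem_smul_set hb) ?_
    rw [mem_hyperplane_iff_not_reachable hX hJ₂]
    refine ⟨(hact _ _ _).2 (hC.1.1 ha hb hab), fun h => ?_⟩
    have h' := ((hN a (hCJ ha)).symm.trans h).trans (hN b (hCJ hb))
    exact ((mem_hyperplane_iff_not_reachable hX hJ₂).1 (hC.2.2 a ha b hb hab)).2 h'
  have h1 := reachable_deleteEdges_gate hX hJ₂ hrC (r • z)
  rw [gate_smul hact hX hC.1] at h1
  exact (h1.trans (hN _ (hCJ (gate_mem hX hC.1 z)))).trans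
    (reachable_deleteEdges_gate hX hJ₂ hC z).symm

omit hact

/-! ### The base region and the peripheral hyperplanes -/

theorem mem_baseRegion_iff {x₀ y : V} :
    y ∈ baseRegion X 𝒥 x₀ ↔ ∀ J ∈ 𝒥, (X.deleteEdges J).Reachable x₀ y := by
  constructor
  · intro h J hJ
    have := h J hJ _ ⟨(X.deleteEdges J).connectedComponentMk x₀, rfl⟩ rfl
    exact (SimpleGraph.ConnectedComponent.eq.1 this).symm
  · rintro h J hJ _ ⟨c, rfl⟩ hx
    exact (SimpleGraph.ConnectedComponent.sound (h J hJ).symm).trans hx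

/-- The largest peripheral subcollection. -/
def peripherals (X : SimpleGraph V) (𝒥 : Set (Set (Sym2 V))) (x₀ : V) : Set (Set (Sym2 V)) :=
  {J ∈ 𝒥 | ¬ ∃ H ∈ 𝒥, Separates X H (nbhd J) {x₀}}

theorem maximal_isPeripheral_iff {x₀ : V} {𝒥₀ : Set (Set (Sym2 V))} :
    Maximal (IsPeripheral X 𝒥 x₀) 𝒥₀ ↔ 𝒥₀ = peripherals X 𝒥 x₀ := by
  have h1 : IsPeripheral X 𝒥 x₀ (peripherals X 𝒥 x₀) := ⟨fun J h => h.1, fun J h => h.2⟩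
  have h2 : ∀ 𝒥₁, IsPeripheral X 𝒥 x₀ 𝒥₁ → 𝒥₁ ≤ peripherals X 𝒥 x₀ :=
    fun 𝒥₁ h J hJ => ⟨h.1 hJ, h.2 J hJ⟩
  constructor
  · exact fun h => le_antisymm (h2 _ h.1) (h.2 h1 (h2 _ h.1))
  · rintro rfl
    exact ⟨h1, fun 𝒥₁ h _ => h2 _ h⟩

/-- A hyperplane adjacent to the base region is peripheral. -/
theorem mem_peripherals_of_mem_baseRegion {x₀ y : V} {J : Set (Sym2 V)} (hJ : J ∈ 𝒥)
    (hy : y ∈ nbhd J) (hyY : y ∈ baseRegion X 𝒥 x₀) : J ∈ peripherals X 𝒥 x₀ := by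
  refine ⟨hJ, ?_⟩
  rintro ⟨H, hH, _, ⟨c, rfl⟩, _, ⟨d, rfl⟩, hne, hc, hd⟩
  have h1 : _ = c := hc hy
  have h2 : _ = d := hd rfl
  have h3 := SimpleGraph.ConnectedComponent.sound (mem_baseRegion_iff.1 hyY H hH)
  exact hne (by rw [← h1, ← h2, h3])

/-- The neighbourhood of a peripheral hyperplane lies in the sector of the base point, with respect
to every other hyperplane of the collection that is not transverse to it. -/
theorem reachable_of_mem_peripherals (hX : IsQuasiMedian X) (h𝒥 : ∀ J ∈ 𝒥, IsHyperplane X J)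
    {x₀ : V} {J₁ J₂ : Set (Sym2 V)} (h₁ : J₁ ∈ 𝒥) (h₂ : J₂ ∈ peripherals X 𝒥 x₀)
    (hne : J₁ ≠ J₂) (ht : ¬ Transverse X J₁ J₂) {x : V} (hx : x ∈ nbhd J₂) :
    (X.deleteEdges J₁).Reachable x₀ x := by
  by_contra h
  refine h₂.2 ⟨J₁, h₁, _, ⟨(X.deleteEdges J₁).connectedComponentMk x, rfl⟩, _,
    ⟨(X.deleteEdges J₁).connectedComponentMk x₀, rfl⟩, fun h' => h ?_, fun y hy => ?_, ?_⟩
  · exact (SimpleGraph.ConnectedComponent.eq.1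
      (SimpleGraph.ConnectedComponent.supp_injective h')).symm
  · exact SimpleGraph.ConnectedComponent.sound
      (reachable_of_not_transverse hX (h𝒥 _ h₁) (h𝒥 _ h₂.1) hne ht hy hx)
  · rw [Set.singleton_subset_iff]
    rfl

/-- For distinct peripheral hyperplanes that are not transverse, every vertex lies in the sector of
the base point with respect to one of the two. -/
theorem reachable_or_reachable_of_mem_peripherals (hX : IsQuasiMedian X)
    (h𝒥 : ∀ J ∈ 𝒥, IsHyperplane X J) {x₀ : V} {J₁ J₂ : Set (Sym2 V)}
    (h₁ : J₁ ∈ peripherals X 𝒥 x₀) (h₂ : J₂ ∈ peripherals X 𝒥 x₀) (hne : J₁ ≠ J₂)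
    (ht : ¬ Transverse X J₁ J₂) (z : V) :
    (X.deleteEdges J₁).Reachable x₀ z ∨ (X.deleteEdges J₂).Reachable x₀ z := by
  by_contra! h
  obtain ⟨hz₁, hz₂⟩ := h
  obtain ⟨a, b, hab⟩ := (h𝒥 _ h₁.1).nonempty
  obtain ⟨C, hC, -⟩ := exists_isCliqueIn hX (h𝒥 _ h₁.1) hab
  -- a path from `z` to `N(J₁)` avoiding `J₁` would have to cross `J₂`, whose neighbourhood lies in
  -- the sector of `x₀` delimited by `J₁`
  have key : ∀ w, (X.deleteEdges J₁).Reachable z w → ¬ (X.deleteEdges J₂).Reachable x₀ w := by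
    intro w hw
    rw [SimpleGraph.reachable_iff_reflTransGen] at hw
    induction hw with
    | refl => exact hz₂
    | @tail u w hu huw ih =>
      intro hw
      rw [← SimpleGraph.reachable_iff_reflTransGen] at hu
      rw [SimpleGraph.deleteEdges_adj] at huw
      have : s(u, w) ∈ J₂ := (mem_hyperplane_iff_not_reachable hX (h𝒥 _ h₂.1)).2
        ⟨huw.1, fun h => ih (hw.trans h.symm)⟩
      exact hz₁ ((reachable_of_mem_peripherals hX h𝒥 h₁.1 h₂ hne ht
        (mem_nbhd_iff.2 ⟨w, this⟩)).trans hu.symm)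
  refine key _ (reachable_deleteEdges_gate hX (h𝒥 _ h₁.1) hC z) ?_
  exact reachable_of_mem_peripherals hX h𝒥 h₂.1 h₁ hne.symm (fun h => ht h.symm)
    (hC.subset_nbhd (gate_mem hX hC.1 z))

include hact

/-! ### The structure of the rotation group -/

variable (hinv : ∀ (g : G), ∀ J ∈ 𝒥, translate g J ∈ 𝒥)
include hinv

theorem smul_mem_baseRegion_iff {x₀ y : V} (g : G) (hg : g • x₀ ∈ baseRegion X 𝒥 x₀) :
    g • y ∈ baseRegion X 𝒥 x₀ ↔ y ∈ baseRegion X 𝒥 x₀ := by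
  rw [mem_baseRegion_iff] at hg ⊢
  rw [mem_baseRegion_iff]
  constructor
  · intro h J hJ
    have := reachable_smul hact ((hg _ (hinv g J hJ)).symm.trans (h _ (hinv g J hJ))) g⁻¹
    rwa [translate_inv_translate, inv_smul_smul, inv_smul_smul] at this
  · intro h J hJ
    have := reachable_smul hact (h _ (hinv g⁻¹ J hJ)) g
    rw [translate_translate_inv] at this
    exact (hg J hJ).trans this

theorem mem_stabilizer_baseRegion_iff {x₀ : V} {g : G} :
    g ∈ MulAction.stabilizer G (baseRegion X 𝒥 x₀) ↔ g • x₀ ∈ baseRegion X 𝒥 x₀ := by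
  rw [MulAction.mem_stabilizer_iff]
  constructor
  · intro h
    rw [← h]
    exact Set.smul_mem_smul_set (mem_baseRegion_iff.2 fun _ _ => .rfl)
  · intro h
    ext y
    rw [Set.mem_smul_set_iff_inv_smul_mem, ← smul_mem_baseRegion_iff hact hinv g h, smul_inv_smul]

theorem rot_normal : (rot G X 𝒥).Normal := by
  refine ⟨fun r hr g => ?_⟩
  induction hr using Subgroup.closure_induction with
  | mem r hr =>
    obtain ⟨J, hJ, hr⟩ := hr
    exact Subgroup.subset_closure ⟨_, hinv g J hJ, conj_mem_rotStab hact hr g⟩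
  | one => simp
  | mul a b _ _ ha hb =>
    have := mul_mem ha hb
    rwa [show g * a * g⁻¹ * (g * b * g⁻¹) = g * (a * b) * g⁻¹ by group] at this
  | inv a _ ha =>
    have := inv_mem ha
    rwa [show (g * a * g⁻¹)⁻¹ = g * a⁻¹ * g⁻¹ by group] at this

/-- The rotations about the peripheral hyperplanes suffice to move any vertex into the base
region: along a path ending in the region, every hyperplane to be crossed becomes peripheral once
the rest of the path has been folded back. -/
theorem exists_smul_mem_baseRegion (hX : IsQuasiMedian X) (h𝒥 : ∀ J ∈ 𝒥, IsHyperplane X J)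
    (hrot : IsRotative G X 𝒥) {x₀ : V} {K : Subgroup G}
    (hK : ∀ J ∈ peripherals X 𝒥 x₀, rotStab G X J ≤ K) (x : V) :
    ∃ k ∈ K, k • x ∈ baseRegion X 𝒥 x₀ := by
  obtain ⟨p⟩ := hX.connected x x₀
  induction p with
  | nil => exact ⟨1, one_mem K, by rw [one_smul]; exact mem_baseRegion_iff.2 fun _ _ => .rfl⟩
  | @cons x y _ hxy _ ih =>
    obtain ⟨k, hk, hky⟩ := ih hK
    by_cases h : ∃ J ∈ 𝒥, s(x, y) ∈ J
    · obtain ⟨J, hJ, hxyJ⟩ := h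
      have hmem : s(k • x, k • y) ∈ translate k J := mk_mem_translate_iff.2 hxyJ
      obtain ⟨r, hr, hrx⟩ := exists_mem_rotStab_smul_eq hact hX hrot (hinv k J hJ)
        (h𝒥 _ (hinv k J hJ)) hmem
      have hper := mem_peripherals_of_mem_baseRegion (hinv k J hJ)
        (mem_nbhd_iff.2 ⟨k • x, by rwa [Sym2.eq_swap]⟩) hky
      exact ⟨r * k, mul_mem (hK _ hper hr) hk, by rwa [mul_smul, hrx]⟩
    · refine ⟨k, hk, mem_baseRegion_iff.2 fun J hJ => ?_⟩
      refine (mem_baseRegion_iff.1 hky J hJ).trans ?_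
      have hadj : (X.deleteEdges (translate k⁻¹ J)).Adj y x := by
        rw [SimpleGraph.deleteEdges_adj, Sym2.eq_swap]
        exact ⟨hxy.symm, fun h' => h ⟨_, hinv k⁻¹ J hJ, h'⟩⟩
      have := reachable_smul hact hadj.reachable k
      rwa [translate_translate_inv] at this

/-- `Rot(𝒥)` is generated by the rotations about peripheral hyperplanes: every hyperplane has a
translate, by such rotations, adjacent to the base region. -/
theorem rot_le_of_peripherals (hX : IsQuasiMedian X) (h𝒥 : ∀ J ∈ 𝒥, IsHyperplane X J)
    (hrot : IsRotative G X 𝒥) {x₀ : V} {K : Subgroup G}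
    (hK : ∀ J ∈ peripherals X 𝒥 x₀, rotStab G X J ≤ K) : rot G X 𝒥 ≤ K := by
  refine (Subgroup.closure_le _).2 ?_
  rintro r ⟨J, hJ, hr⟩
  obtain ⟨a, b, hab⟩ := (h𝒥 J hJ).nonempty
  obtain ⟨k, hk, hka⟩ := exists_smul_mem_baseRegion hact hinv hX h𝒥 hrot hK a
  have hper := mem_peripherals_of_mem_baseRegion (hinv k J hJ)
    (mem_nbhd_iff.2 ⟨k • b, mk_mem_translate_iff.2 hab⟩) hka
  have := mul_mem (mul_mem (inv_mem hk) (hK _ hper (conj_mem_rotStab hact hr k))) hk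
  rwa [show k⁻¹ * (k * r * k⁻¹) * k = r by group] at this

end Action

end QuasiMedian

theorem mainTheorem11 {V : Type*} {G : Type*} [Group G] [MulAction G V]
    (X : SimpleGraph V) (hX : QuasiMedian.IsQuasiMedian X)
    (hact : ∀ (g : G) (a b : V), X.Adj (g • a) (g • b) ↔ X.Adj a b)
    (𝒥 : Set (Set (Sym2 V)))
    (h𝒥 : ∀ J ∈ 𝒥, QuasiMedian.IsHyperplane X J)
    (hinv : ∀ (g : G), ∀ J ∈ 𝒥, Sym2.map (fun a => g • a) '' J ∈ 𝒥)
    (hrot : QuasiMedian.IsRotative G X 𝒥)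
    (x₀ : V)
    (hcomm : ∀ J₁ ∈ 𝒥, ∀ J₂ ∈ 𝒥, QuasiMedian.Transverse X J₁ J₂ →
      ∀ g₁ ∈ QuasiMedian.rotStab G X J₁, ∀ g₂ ∈ QuasiMedian.rotStab G X J₂, Commute g₁ g₂) :
    -- `G` is the internal semidirect product of `Rot(𝒥)` and `stab(Y)`
    ((QuasiMedian.rot G X 𝒥).Normal ∧
      Subgroup.IsComplement' (QuasiMedian.rot G X 𝒥)
        (MulAction.stabilizer G (QuasiMedian.baseRegion X 𝒥 x₀))) ∧
    -- there is a unique maximal peripheral subcollection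
    (∃! 𝒥₀, Maximal (QuasiMedian.IsPeripheral X 𝒥 x₀) 𝒥₀) ∧
    -- the inclusions of the rotative stabilisers induce an isomorphism from the graph product
    (∀ 𝒥₀, Maximal (QuasiMedian.IsPeripheral X 𝒥 x₀) 𝒥₀ →
      ∃ φ : QuasiMedian.GraphProduct (QuasiMedian.transversalityGraph X 𝒥₀)
          (fun J : 𝒥₀ => QuasiMedian.rotStab G X J.1) ≃* QuasiMedian.rot G X 𝒥,
        ∀ (J : 𝒥₀) (g : QuasiMedian.rotStab G X J.1),
          ((φ (QuasiMedian.GraphProduct.of _ _ J g) : QuasiMedian.rot G X 𝒥) : G) = g) := by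
  open QuasiMedian in
  let P₀ := peripherals X 𝒥 x₀
  have htrans : ∀ J₁ J₂ : P₀, (transversalityGraph X P₀).Adj J₁ J₂ →
      J₁.1 ≠ J₂.1 ∧ Transverse X J₁.1 J₂.1 := by
    intro J₁ J₂ h
    rw [transversalityGraph, SimpleGraph.fromRel_adj] at h
    exact ⟨fun h' => h.1 (Subtype.ext h'), h.2.elim id Transverse.symm⟩
  have hcomm' : ∀ J₁ J₂ : P₀, (transversalityGraph X P₀).Adj J₁ J₂ →
      ∀ (a : rotStab G X J₁.1) (b : rotStab G X J₂.1),
        Commute ((rotStab G X J₁.1).subtype a) ((rotStab G X J₂.1).subtype b) :=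
    fun J₁ J₂ h a b => hcomm _ J₁.2.1 _ J₂.2.1 (htrans _ _ h).2 _ a.2 _ b.2
  let Φ : GraphProduct (transversalityGraph X P₀) (fun J : P₀ => rotStab G X J.1) →* G :=
    GraphProduct.lift (fun J : P₀ => (rotStab G X J.1).subtype) hcomm'
  have hΦ : ∀ (J : P₀) (g : rotStab G X J.1), Φ (GraphProduct.of _ _ J g) = g :=
    fun J g => GraphProduct.lift_of (fun J : P₀ => (rotStab G X J.1).subtype) hcomm' J g
  have hle : ∀ J : P₀, rotStab G X J.1 ≤ rot G X 𝒥 :=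
    fun J g hg => Subgroup.subset_closure ⟨J.1, J.2.1, hg⟩
  -- ping-pong with the complements of the sectors containing `x₀`
  have hping : ∀ w, w ≠ 1 → Φ w • x₀ ∉ baseRegion X 𝒥 x₀ := by
    intro w hw h
    obtain ⟨J, hJ⟩ := GraphProduct.exists_smul_mem_of_ne_one Φ x₀
      (fun J : P₀ => {z | ¬ (X.deleteEdges J.1).Reachable x₀ z})
      (fun J h => h .rfl)
      (fun J a ha z hz => by
        rw [hΦ]
        exact not_reachable_smul hact hX hrot J.2.1 (h𝒥 _ J.2.1) a.2
          (fun h => ha (Subtype.ext h)) (not_not.1 hz))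
      (fun J₁ J₂ hne hΓ => by
        rw [Set.disjoint_left]
        intro z h₁ h₂
        refine (reachable_or_reachable_of_mem_peripherals hX h𝒥 J₁.2 J₂.2
          (fun h => hne (Subtype.ext h)) (fun h => hΓ ?_) z).elim h₁ h₂
        rw [transversalityGraph, SimpleGraph.fromRel_adj]
        exact ⟨hne, .inl h⟩)
      (fun J₁ J₂ hΓ a z hz h => by
        rw [hΦ] at hz
        obtain ⟨hne, ht⟩ := htrans _ _ hΓ
        exact hz (h.trans (reachable_smul_of_transverse hact hX (h𝒥 _ J₁.2.1) (h𝒥 _ J₂.2.1)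
          hne ht a.2 z).symm))
      hw
    exact hJ (mem_baseRegion_iff.1 h J.1 J.2.1)
  have hrange : Φ.range = rot G X 𝒥 := by
    apply le_antisymm
    · rintro _ ⟨w, rfl⟩
      obtain ⟨L, rfl⟩ := GraphProduct.exists_wordProd_eq w
      induction L with
      | nil => exact one_mem _
      | cons s L ih =>
        rw [GraphProduct.wordProd_cons, map_mul, hΦ]
        exact mul_mem (hle s.1 s.2.2) ih
    · exact rot_le_of_peripherals hact hinv hX h𝒥 hrot fun J hJ g hg =>
        ⟨GraphProduct.of _ _ (⟨J, hJ⟩ : P₀) ⟨g, hg⟩, hΦ ⟨J, hJ⟩ ⟨g, hg⟩⟩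
  refine ⟨⟨rot_normal hact hinv, ?_⟩, ⟨P₀, maximal_isPeripheral_iff.2 rfl,
    fun _ h => maximal_isPeripheral_iff.1 h⟩, ?_⟩
  · refine Subgroup.isComplement'_of_disjoint_and_mul_eq_univ ?_ ?_
    · rw [Subgroup.disjoint_def]
      intro r hr hr'
      rw [← hrange] at hr
      obtain ⟨w, rfl⟩ := hr
      by_contra hne
      refine hping w ?_ ((mem_stabilizer_baseRegion_iff hact hinv).1 hr')
      rintro rfl
      exact hne (map_one Φ)
    · refine Set.eq_univ_of_forall fun g => ?_
      obtain ⟨k, hk, hkg⟩ := exists_smul_mem_baseRegion hact hinv hX h𝒥 hrot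
        (fun J hJ => hle ⟨J, hJ⟩) (g • x₀)
      refine ⟨k⁻¹, inv_mem hk, k * g, ?_, inv_mul_cancel_left k g⟩
      rw [SetLike.mem_coe, mem_stabilizer_baseRegion_iff hact hinv, mul_smul]
      exact hkg
  · intro 𝒥₀ h𝒥₀
    obtain rfl := maximal_isPeripheral_iff.1 h𝒥₀
    have hinj : Function.Injective Φ := by
      rw [injective_iff_map_eq_one]
      intro w hw
      by_contra hne
      refine hping w hne ?_
      rw [hw, one_smul]
      exact mem_baseRegion_iff.2 fun _ _ => .rfl
    exact ⟨(MonoidHom.ofInjective hinj).trans (MulEquiv.subgroupCongr hrange), hΦ⟩
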